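/- Let $\Omega$ be a locally compact, second countable Hausdorff space with Borel $\sigma$-algebra $\mathcal B(\Omega)$, and let $\mathcal H$ be a separable complex Hilbert space with bounded operators $\mathcal L(\mathcal H)$. A *POVM* on a measurable space $S$ (with values in $\mathcal L(\mathcal H)$) is a map $\mathsf E$ from the measurable sets of $S$ to the positive operators in $\mathcal L(\mathcal H)$ with $\mathsf E(S)=I$ that is $\sigma$-additive in the weak operator topology; it is a *PVM* if $\mathsf E(X\cap Y)=\mathsf E(X)\mathsf E(Y)$ for all measurable $X,Y$. For a bounded measurable $\phi:S\to\mathbb C$, $\mathsf E(\phi)=\int_S\phi\,d\mathsf E\in\mathcal L(\mathcal H)$ is the unique operator with $\langle\psi,\mathsf E(\phi)\psi\rangle=\int_S\phi(x)\,\langle\psi,\mathsf E(dx)\psi\rangle$ for all $\psi\in\mathcal H$. If $S$ is a topological space with its Borel $\sigma$-algebra, $\mathsf E'$ denotes the commutant of $\{\mathsf E(f)\mid f\in C_0(S)\}$ in $\mathcal L(\mathcal H)$, where $C_0(S)$ is the space of continuous complex functions on $S$ vanishing at infinity; $\mathsf E$ is *commutative* if $\mathsf E(X)\in\mathsf E'$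 for all Borel sets $X$. Let $B(\Omega)^+$ be the set of positive Borel measures $\mu$ on $\Omega$ with $\mu(\Omega)\le 1$, with the weak*-topology (the coarsest one making $\mu\mapsto\mu(f)=\int_\Omega f\,d\mu$ continuous for every $f\in C_0(\Omega)$) and its Borel $\sigma$-algebra, and let $P(\Omega)=\{\mu\in B(\Omega)^+\mid\mu(\Omega)=1\}$. **Theorem.** Let $\mathsf E$ be a commutative POVM on $\Omega$. Then there exists a unique PVM $\mathsf P$ on $B(\Omega)^+$ such that $$\mathsf E(f)=\int_{B(\Omega)^+}\mu(f)\,d\mathsf P(\mu)\qquad\forall f\in C_0(\Omega),\tag{1}$$ and for a PVM $\mathsf P$ on $B(\Omega)^+$ condition (1) is equivalent to $$\mathsf E(X)=\int_{B(\Omega)^+}\mu(X)\,d\mathsf P(\mu)\qquad\forall X\in\mathcal B(\Omega).\tag{2}$$ Moreover, for this $\mathsf P$, the set $B(\Omega)^+\setminus P(\Omega)$ is a Borel set with $\mathsf P(B(\Omega)^+\setminus P(\Omega))=0$, and $\mathsf E'=\mathsf P'$. -/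

import Mathlib

open MeasureTheory Filter
open scoped Topology ENNReal InnerProductSpace ZeroAtInfty

noncomputable section

/-- A (normalized) positive operator valued measure on a measurable space `α`, with values in the
bounded operators of the Hilbert space `H`. The set function is `σ`-additive in the weak operator
topology. As for `MeasureTheory.VectorMeasure`, it takes the dummy value `0` on the sets that are
not measurable, so that two such measures are equal as soon as they agree on measurable sets. -/
structure POVM (α : Type*) [MeasurableSpace α] (H : Type*) [NormedAddCommGroup H]
    [InnerProductSpace ℂ H] [CompleteSpace H] where
  /-- The operator `E(X)`. -/
  toFun : Set α → H →L[ℂ] H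
  not_measurable' : ∀ X, ¬ MeasurableSet X → toFun X = 0
  isPositive' : ∀ X, MeasurableSet X → (toFun X).IsPositive
  univ' : toFun Set.univ = 1
  empty' : toFun ∅ = 0
  hasSum' : ∀ X : ℕ → Set α, (∀ i, MeasurableSet (X i)) → Pairwise (Function.onFun Disjoint X) →
    ∀ φ ψ : H, HasSum (fun i => ⟪φ, toFun (X i) ψ⟫_ℂ) ⟪φ, toFun (⋃ i, X i) ψ⟫_ℂ

namespace POVM

variable {α : Type*} [MeasurableSpace α] {H : Type*} [NormedAddCommGroup H]
  [InnerProductSpace ℂ H] [CompleteSpace H]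

instance : CoeFun (POVM α H) (fun _ => Set α → H →L[ℂ] H) := ⟨POVM.toFun⟩

theorem isPositive (E : POVM α H) (X : Set α) : (E X).IsPositive := by
  by_cases h : MeasurableSet X
  · exact E.isPositive' X h
  · rw [E.not_measurable' X h]; exact ContinuousLinearMap.isPositive_zero

/-- A projection valued measure (sharp observable): `E(X ∩ Y) = E(X) E(Y)`. -/
def IsSharp (E : POVM α H) : Prop :=
  ∀ X Y : Set α, MeasurableSet X → MeasurableSet Y → E (X ∩ Y) = E X * E Y

/-- The finite positive measure `X ↦ ⟪ψ, E(X) ψ⟫`. For a unit vector `ψ` it is the outcome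
distribution of `E` in the state `ψ`. -/
def scalarMeasure (E : POVM α H) (ψ : H) : Measure α :=
  Measure.ofMeasurable (fun X _ => ENNReal.ofReal (⟪ψ, E X ψ⟫_ℂ).re)
    (by simp [E.empty'])
    (by
      intro X hX hd
      have h := (Complex.hasSum_re (E.hasSum' X hX hd ψ ψ))
      rw [← h.tsum_eq, ENNReal.ofReal_tsum_of_nonneg _ h.summable]
      intro i
      exact (E.isPositive (X i)).re_inner_nonneg_right ψ)

theorem scalarMeasure_apply (E : POVM α H) (ψ : H) {X : Set α} (hX : MeasurableSet X) :
    E.scalarMeasure ψ X = ENNReal.ofReal (⟪ψ, E X ψ⟫_ℂ).re :=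
  Measure.ofMeasurable_apply X hX

theorem scalarMeasure_univ (E : POVM α H) (ψ : H) :
    E.scalarMeasure ψ Set.univ = ENNReal.ofReal (‖ψ‖ ^ 2) := by
  rw [scalarMeasure_apply _ _ MeasurableSet.univ, E.univ']
  congr 1
  exact inner_self_eq_norm_sq (𝕜 := ℂ) ψ

instance (E : POVM α H) (ψ : H) : IsFiniteMeasure (E.scalarMeasure ψ) :=
  ⟨by rw [scalarMeasure_univ]; exact ENNReal.ofReal_lt_top⟩

/-- The bounded operator `A` is the weak integral `∫ f dE`: its expectations in all vector states
are the integrals of `f` against the outcome distributions of `E`. -/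
def IsIntegral (E : POVM α H) (f : α → ℂ) (A : H →L[ℂ] H) : Prop :=
  ∀ ψ : H, Integrable f (E.scalarMeasure ψ) ∧ ⟪ψ, A ψ⟫_ℂ = ∫ x, f x ∂(E.scalarMeasure ψ)

open Classical in
/-- The bounded operator `E(f) = ∫ f dE`. It exists and is characterized by `IsIntegral` for every
bounded measurable `f`, see `isIntegral_integral` and `IsIntegral.unique`. -/
def integral (E : POVM α H) (f : α → ℂ) : H →L[ℂ] H :=
  if h : ∃ A, E.IsIntegral f A then h.choose else 0

theorem IsIntegral.unique {E : POVM α H} {f : α → ℂ} {A B : H →L[ℂ] H}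
    (hA : E.IsIntegral f A) (hB : E.IsIntegral f B) : A = B := by
  have : (A : H →ₗ[ℂ] H) = (B : H →ₗ[ℂ] H) := by
    rw [← ext_inner_map]
    intro ψ
    have := (hA ψ).2.trans (hB ψ).2.symm
    have h2 := congrArg (starRingEnd ℂ) this
    simpa [inner_conj_symm] using h2
  ext x
  exact LinearMap.congr_fun this x

theorem isIntegral_simpleFunc (E : POVM α H) (s : SimpleFunc α ℂ) :
    E.IsIntegral s (∑ c ∈ s.range, c • E (s ⁻¹' {c})) := by
  intro ψ
  have hint : Integrable s (E.scalarMeasure ψ) := SimpleFunc.integrable_of_isFiniteMeasure s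
  refine ⟨hint, ?_⟩
  rw [SimpleFunc.integral_eq_sum s hint, sum_apply, inner_sum]
  refine Finset.sum_congr rfl fun c _ => ?_
  have hpos := E.isPositive (s ⁻¹' {c})
  have hre : ((⟪ψ, E (s ⁻¹' {c}) ψ⟫_ℂ).re : ℂ) = ⟪ψ, E (s ⁻¹' {c}) ψ⟫_ℂ := by
    have h := hpos.inner_nonneg_right ψ
    exact (Complex.eq_re_of_ofReal_le (r := 0) (by simpa using h)).symm
  rw [Measure.real, scalarMeasure_apply _ _ (s.measurableSet_preimage _),
    ENNReal.toReal_ofReal (show 0 ≤ (⟪ψ, E (s ⁻¹' {c}) ψ⟫_ℂ).re from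
      hpos.re_inner_nonneg_right ψ), smul_apply,
    inner_smul_right, Complex.real_smul, hre, mul_comm]

theorem exists_isIntegral (E : POVM α H) {f : α → ℂ} (hf : Measurable f) {C : ℝ}
    (hC : ∀ x, ‖f x‖ ≤ C) : ∃ A, E.IsIntegral f A := by
  rcases isEmpty_or_nonempty α with hα | ⟨⟨x₀⟩⟩
  · refine ⟨0, fun ψ => ⟨?_, ?_⟩⟩
    · simp [Measure.eq_zero_of_isEmpty]
    · simp [Measure.eq_zero_of_isEmpty]
  have hC0 : 0 ≤ C := (norm_nonneg _).trans (hC x₀)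
  have hsm := hf.stronglyMeasurable
  let s : ℕ → SimpleFunc α ℂ := fun n => hsm.approxBounded C n
  let A : ℕ → H →L[ℂ] H := fun n => ∑ c ∈ (s n).range, c • E (s n ⁻¹' {c})
  have hA : ∀ n, E.IsIntegral (s n) (A n) := fun n => E.isIntegral_simpleFunc (s n)
  have hq : ∀ ψ, Tendsto (fun n => ⟪A n ψ, ψ⟫_ℂ) atTop
      (𝓝 (starRingEnd ℂ (∫ x, f x ∂(E.scalarMeasure ψ)))) := by
    intro ψ
    have h : Tendsto (fun n => ∫ x, s n x ∂(E.scalarMeasure ψ)) atTop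
        (𝓝 (∫ x, f x ∂(E.scalarMeasure ψ))) :=
      tendsto_integral_of_dominated_convergence (fun _ => C)
        (fun n => (s n).stronglyMeasurable.aestronglyMeasurable) (integrable_const C)
        (fun n => ae_of_all _ fun x => hsm.norm_approxBounded_le hC0 n x)
        (ae_of_all _ fun x => hsm.tendsto_approxBounded_of_norm_le (hC x))
    have h2 := (Complex.continuous_conj.tendsto _).comp h
    refine h2.congr fun n => ?_
    simp only [Function.comp_apply]
    rw [← (hA n ψ).2, inner_conj_symm]
  have hlim : ∀ x y, ∃ b, Tendsto (fun n => ⟪A n y, x⟫_ℂ) atTop (𝓝 b) := by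
    intro x y
    refine ⟨_, Tendsto.congr (fun n => (inner_map_polarization (A n : H →ₗ[ℂ] H) x y).symm)
      (((((hq (x + y)).sub (hq (x - y))).add ((hq (x + Complex.I • y)).const_mul Complex.I)).sub
        ((hq (x - Complex.I • y)).const_mul Complex.I)).div_const 4)⟩
  choose b hb using hlim
  obtain ⟨K, hK⟩ : ∃ K, ∀ n, ‖A n‖ ≤ K := by
    apply banach_steinhaus
    intro y
    obtain ⟨K, hK⟩ : ∃ K, ∀ n, ‖InnerProductSpace.toDual ℂ H (A n y)‖ ≤ K := by
      apply banach_steinhaus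
      intro x
      obtain ⟨K, hK⟩ := (Metric.isBounded_range_of_tendsto _ (hb x y)).exists_norm_le
      exact ⟨K, fun n => by simpa using hK _ (Set.mem_range_self n)⟩
    exact ⟨K, fun n => by simpa using hK n⟩
  let B : H →ₗ⋆[ℂ] H →ₗ[ℂ] ℂ := LinearMap.mk₂'ₛₗ (starRingEnd ℂ) (RingHom.id ℂ) (fun y x => b x y)
    (fun y y' x => tendsto_nhds_unique (hb _ _)
      (((hb x y).add (hb x y')).congr fun n => by rw [map_add, inner_add_left]))
    (fun c y x => tendsto_nhds_unique (hb _ _)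
      (((hb x y).const_mul _).congr fun n => by rw [map_smul, inner_smul_left]))
    (fun y x x' => tendsto_nhds_unique (hb _ _)
      (((hb x y).add (hb x' y)).congr fun n => by rw [inner_add_right]))
    (fun c y x => tendsto_nhds_unique (hb _ _)
      (((hb x y).const_mul _).congr fun n => by rw [inner_smul_right]; rfl))
  have hBb : ∀ y x, ‖B y x‖ ≤ K * ‖y‖ * ‖x‖ := by
    intro y x
    refine le_of_tendsto (hb x y).norm (Eventually.of_forall fun n => ?_)
    calc ‖⟪A n y, x⟫_ℂ‖ ≤ ‖A n y‖ * ‖x‖ := norm_inner_le_norm _ _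
      _ ≤ K * ‖y‖ * ‖x‖ := by
        gcongr
        exact (A n).le_of_opNorm_le (hK n) y
  refine ⟨InnerProductSpace.continuousLinearMapOfBilin (B.mkContinuous₂ K hBb), fun ψ => ⟨?_, ?_⟩⟩
  · exact Integrable.of_bound hsm.aestronglyMeasurable C (ae_of_all _ hC)
  · rw [← inner_conj_symm, InnerProductSpace.continuousLinearMapOfBilin_apply,
      LinearMap.mkContinuous₂_apply]
    have : B ψ ψ = starRingEnd ℂ (∫ x, f x ∂(E.scalarMeasure ψ)) :=
      tendsto_nhds_unique (hb ψ ψ) (hq ψ)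
    rw [this, Complex.conj_conj]

/-- Every bounded measurable function has an integral. -/
theorem isIntegral_integral (E : POVM α H) {f : α → ℂ} (hf : Measurable f) {C : ℝ}
    (hC : ∀ x, ‖f x‖ ≤ C) : E.IsIntegral f (E.integral f) := by
  have h := E.exists_isIntegral hf hC
  rw [integral, dif_pos h]
  exact h.choose_spec

/-- The commutant `E′` of `{E(f) | f ∈ C₀(Ω)}` in the bounded operators. -/
def commutant [TopologicalSpace α] (E : POVM α H) : Set (H →L[ℂ] H) :=
  Set.centralizer (Set.range fun f : C₀(α, ℂ) => E.integral f)

/-- `E` is commutative if `E(X) ∈ E′` for all Borel sets `X`. -/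
def IsCommutative [TopologicalSpace α] (E : POVM α H) : Prop :=
  ∀ X : Set α, MeasurableSet X → E X ∈ E.commutant

end POVM

/-- The set `B(Ω)⁺` of positive measures on `Ω` of total mass at most one. -/
structure SubprobabilityMeasure (Ω : Type*) [MeasurableSpace Ω] where
  /-- The underlying measure. -/
  toMeasure : Measure Ω
  measure_univ_le_one : toMeasure Set.univ ≤ 1

namespace SubprobabilityMeasure

variable {Ω : Type*} [MeasurableSpace Ω]

/-- The weak-* topology of `B(Ω)⁺`, as a subset of the dual of `C₀(Ω)`: the coarsest topology for
which all the maps `μ ↦ μ(f) = ∫ f dμ`, `f ∈ C₀(Ω)`, are continuous. -/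
instance [TopologicalSpace Ω] : TopologicalSpace (SubprobabilityMeasure Ω) :=
  TopologicalSpace.induced
    (fun (μ : SubprobabilityMeasure Ω) (f : C₀(Ω, ℂ)) => ∫ x, f x ∂μ.toMeasure) inferInstance

/-- `B(Ω)⁺` carries the Borel `σ`-algebra of its weak-* topology. -/
instance [TopologicalSpace Ω] : MeasurableSpace (SubprobabilityMeasure Ω) := borel _

instance [TopologicalSpace Ω] : BorelSpace (SubprobabilityMeasure Ω) := ⟨rfl⟩

/-- The subset `P(Ω)` of probability measures in `B(Ω)⁺`. -/
def probabilityMeasures (Ω : Type*) [MeasurableSpace Ω] : Set (SubprobabilityMeasure Ω) :=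
  {μ | μ.toMeasure Set.univ = 1}

end SubprobabilityMeasure

/-- The representation `E(f) = ∫ μ(f) dP(μ)` for all `f ∈ C₀(Ω)`. -/
def POVM.RepresentsOnFunctions {Ω : Type*} [TopologicalSpace Ω] [MeasurableSpace Ω] {H : Type*}
    [NormedAddCommGroup H] [InnerProductSpace ℂ H] [CompleteSpace H]
    (P : POVM (SubprobabilityMeasure Ω) H) (E : POVM Ω H) : Prop :=
  ∀ f : C₀(Ω, ℂ), E.integral f =
    P.integral (fun μ : SubprobabilityMeasure Ω => ∫ x, f x ∂μ.toMeasure)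

/-- The representation `E(X) = ∫ μ(X) dP(μ)` for all Borel sets `X`. -/
def POVM.RepresentsOnSets {Ω : Type*} [TopologicalSpace Ω] [MeasurableSpace Ω] {H : Type*}
    [NormedAddCommGroup H] [InnerProductSpace ℂ H] [CompleteSpace H]
    (P : POVM (SubprobabilityMeasure Ω) H) (E : POVM Ω H) : Prop :=
  ∀ X : Set Ω, MeasurableSet X →
    E X = P.integral (fun μ : SubprobabilityMeasure Ω => ((μ.toMeasure.real X : ℝ) : ℂ))

end

/-! Let `S` be the commutative C⋆-algebra generated by the operators `E(f)` with `f ∈ C₀(Ω)`. Every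
character `χ` of `S` restricts to a positive functional `f ↦ χ(E(f))` of norm at most one, which by
the Riesz theorem is a point of `B(Ω)⁺`. Composing the resulting continuous map from the spectrum
of `S` to `B(Ω)⁺` with the inverse Gelfand transform gives a representation of `C(B(Ω)⁺)` that sends
`μ ↦ μ(f)` to `E(f)`, and its spectral measure is `P`.

For fixed `P` both sides of (1) and (2) are linear in the integrand and respect bounded pointwise
limits, so it makes no difference whether they are compared on `C₀(Ω)`, on indicators, or on all
bounded Borel functions. The function `1` yields `∫ μ(Ω) dP(μ) = I`, hence `μ(Ω) = 1` for
`P`-almost all `μ`. By the Stone–Weierstrass theorem the functions `μ ↦ μ(f)` generate the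
continuous functions on the compact metrizable space `B(Ω)⁺`, which gives the uniqueness of `P` and
the equality of the commutants. -/

noncomputable section

open scoped ComplexOrder CompactlySupported

section BoundedMeasurable

variable {α : Type*} [MeasurableSpace α] {f g : α → ℂ} {F : ℕ → α → ℂ}

/-- Bounded measurable complex functions, the integrands of a POVM. -/
structure BoundedMeasurable (f : α → ℂ) : Prop where
  measurable : Measurable f
  bounded : ∃ C : ℝ, ∀ x, ‖f x‖ ≤ C

namespace BoundedMeasurable

theorem add (hf : BoundedMeasurable f) (hg : BoundedMeasurable g) : BoundedMeasurable (f + g) := by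
  obtain ⟨⟨C, hC⟩, ⟨D, hD⟩⟩ := And.intro hf.bounded hg.bounded
  exact ⟨hf.measurable.add hg.measurable, C + D, fun x =>
    (norm_add_le _ _).trans (add_le_add (hC x) (hD x))⟩

theorem smul (c : ℂ) (hf : BoundedMeasurable f) : BoundedMeasurable (c • f) := by
  obtain ⟨C, hC⟩ := hf.bounded
  exact ⟨hf.measurable.const_smul c, ‖c‖ * C, fun x =>
    (norm_smul_le _ _).trans (mul_le_mul_of_nonneg_left (hC x) (norm_nonneg c))⟩

theorem mul (hf : BoundedMeasurable f) (hg : BoundedMeasurable g) : BoundedMeasurable (f * g) := by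
  obtain ⟨⟨C, hC⟩, ⟨D, hD⟩⟩ := And.intro hf.bounded hg.bounded
  exact ⟨hf.measurable.mul hg.measurable, C * D, fun x => (norm_mul_le _ _).trans
    (mul_le_mul (hC x) (hD x) (norm_nonneg _) ((norm_nonneg _).trans (hC x)))⟩

protected theorem star (hf : BoundedMeasurable f) : BoundedMeasurable (star f) := by
  obtain ⟨C, hC⟩ := hf.bounded
  exact ⟨Complex.continuous_conj.measurable.comp hf.measurable, C, fun x => by simpa using hC x⟩

theorem integrable (hf : BoundedMeasurable f) (μ : Measure α) [IsFiniteMeasure μ] :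
    Integrable f μ := by
  obtain ⟨C, hC⟩ := hf.bounded
  exact .of_bound hf.measurable.aestronglyMeasurable C (ae_of_all _ hC)

end BoundedMeasurable

theorem boundedMeasurable_indicator {X : Set α} (hX : MeasurableSet X) :
    BoundedMeasurable (X.indicator (1 : α → ℂ)) :=
  ⟨measurable_one.indicator hX, 1, fun x => by by_cases h : x ∈ X <;> simp [h]⟩

theorem boundedMeasurable_one : BoundedMeasurable (1 : α → ℂ) := by
  simpa using boundedMeasurable_indicator (α := α) .univ

theorem boundedMeasurable_simpleFunc (s : SimpleFunc α ℂ) : BoundedMeasurable s :=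
  ⟨s.measurable, s.exists_forall_norm_le⟩

theorem boundedMeasurable_zeroAtInfty [TopologicalSpace α] [OpensMeasurableSpace α]
    (f : C₀(α, ℂ)) : BoundedMeasurable f :=
  ⟨(map_continuous f).measurable, ‖f‖, f.toBCF.norm_coe_le_norm⟩

theorem boundedMeasurable_continuousMap [TopologicalSpace α] [CompactSpace α]
    [OpensMeasurableSpace α] (f : C(α, ℂ)) : BoundedMeasurable f :=
  ⟨f.continuous.measurable, ‖f‖, f.norm_coe_le_norm⟩

/-- Pointwise convergence of a uniformly bounded sequence of functions: the mode of convergence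
respected by integrals against finite measures. -/
structure TendstoBoundedly {α : Type*} (F : ℕ → α → ℂ) (f : α → ℂ) : Prop where
  bounded : ∃ C : ℝ, ∀ n x, ‖F n x‖ ≤ C
  tendsto : ∀ x, Tendsto (fun n => F n x) atTop (𝓝 (f x))

namespace TendstoBoundedly

theorem boundedMeasurable (h : TendstoBoundedly F f) (hF : ∀ n, BoundedMeasurable (F n)) :
    BoundedMeasurable f := by
  obtain ⟨C, hC⟩ := h.bounded
  refine ⟨measurable_of_tendsto_metrizable (fun n => (hF n).measurable)
    (tendsto_pi_nhds.2 h.tendsto), C, fun x => ?_⟩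
  exact le_of_tendsto (h.tendsto x).norm (.of_forall fun n => hC n x)

theorem mul_const (h : TendstoBoundedly F f) (hg : BoundedMeasurable g) :
    TendstoBoundedly (fun n => F n * g) (f * g) := by
  obtain ⟨⟨C, hC⟩, ⟨D, hD⟩⟩ := And.intro h.bounded hg.bounded
  exact ⟨⟨C * D, fun n x => (norm_mul_le _ _).trans
      (mul_le_mul (hC n x) (hD x) (norm_nonneg _) ((norm_nonneg _).trans (hC n x)))⟩,
    fun x => (h.tendsto x).mul_const _⟩

theorem integral (h : TendstoBoundedly F f) (hF : ∀ n, BoundedMeasurable (F n)) (μ : Measure α)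
    [IsFiniteMeasure μ] : Tendsto (fun n => ∫ x, F n x ∂μ) atTop (𝓝 (∫ x, f x ∂μ)) := by
  obtain ⟨C, hC⟩ := h.bounded
  exact tendsto_integral_of_dominated_convergence (fun _ => C)
    (fun n => (hF n).measurable.aestronglyMeasurable) (integrable_const C)
    (fun n => ae_of_all _ (hC n)) (ae_of_all _ h.tendsto)

end TendstoBoundedly

theorem BoundedMeasurable.exists_simpleFunc_tendstoBoundedly (hf : BoundedMeasurable f) :
    ∃ s : ℕ → SimpleFunc α ℂ, TendstoBoundedly (fun n => s n) f := by
  obtain ⟨C, hC⟩ := hf.bounded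
  have hC' x : ‖f x‖ ≤ |C| := (hC x).trans (le_abs_self C)
  have hsm := hf.measurable.stronglyMeasurable
  exact ⟨hsm.approxBounded |C|, ⟨|C|, hsm.norm_approxBounded_le (abs_nonneg C)⟩,
    fun x => hsm.tendsto_approxBounded_of_norm_le (hC' x)⟩

theorem tendstoBoundedly_indicator_iUnion {ι : Type*} (X : ℕ → Set ι) :
    TendstoBoundedly (fun n => (⋃ i ∈ Finset.range n, X i).indicator 1)
      ((⋃ i, X i).indicator 1) :=
  ⟨⟨1, fun n x => (norm_indicator_le_norm_self (1 : ι → ℂ) x).trans (by simp)⟩, fun x =>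
    ((tendsto_indicator_biUnion_finset X (1 : ι → ℂ) x).mono_right
      (pure_le_nhds _)).comp tendsto_finset_range⟩

/-- A property of functions that is preserved by linear combinations and by bounded pointwise limits
of bounded measurable functions, for use in monotone class arguments. -/
structure BoundedClosed (p : (α → ℂ) → Prop) : Prop where
  add : ∀ f g, BoundedMeasurable f → BoundedMeasurable g → p f → p g → p (f + g)
  smul : ∀ (c : ℂ) f, BoundedMeasurable f → p f → p (c • f)
  lim : ∀ (F : ℕ → α → ℂ) f, (∀ n, BoundedMeasurable (F n)) → TendstoBoundedly F f →
    (∀ n, p (F n)) → p f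

theorem boundedClosed_integral_eq (μ ν : Measure α) [IsFiniteMeasure μ] [IsFiniteMeasure ν] :
    BoundedClosed fun f : α → ℂ => ∫ x, f x ∂μ = ∫ x, f x ∂ν where
  add f g hf hg hfp hgp := by
    simp only [Pi.add_apply, integral_add (hf.integrable _) (hg.integrable _), hfp, hgp]
  smul c f _ hfp := by simp only [Pi.smul_apply, integral_smul, hfp]
  lim F f hF h hFp := tendsto_nhds_unique (h.integral hF μ)
    ((h.integral hF ν).congr fun n => (hFp n).symm)

theorem integral_indicator_one_complex (μ : Measure α) {X : Set α} (hX : MeasurableSet X) :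
    ∫ x, X.indicator (1 : α → ℂ) x ∂μ = ((μ.real X : ℝ) : ℂ) := by
  simp [integral_indicator hX]

/-- A set of bounded measurable functions which generates all of them under linear combinations and
bounded pointwise limits. -/
structure IsDetermining (S : Set (α → ℂ)) : Prop where
  boundedMeasurable : ∀ f ∈ S, BoundedMeasurable f
  induction : ∀ p : (α → ℂ) → Prop, BoundedClosed p → (∀ f ∈ S, p f) →
    ∀ f, BoundedMeasurable f → p f

theorem isDetermining_indicator :
    IsDetermining {f : α → ℂ | ∃ X, MeasurableSet X ∧ f = X.indicator 1} where
  boundedMeasurable := by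
    rintro _ ⟨X, hX, rfl⟩
    exact boundedMeasurable_indicator hX
  induction p hp hind f hf := by
    obtain ⟨s, hs⟩ := hf.exists_simpleFunc_tendstoBoundedly
    refine hp.lim _ _ (fun n => boundedMeasurable_simpleFunc (s n)) hs fun n => ?_
    induction s n using SimpleFunc.induction with
    | @const c X hX =>
      convert hp.smul c _ (boundedMeasurable_indicator hX) (hind _ ⟨X, hX, rfl⟩) using 1
      ext x
      by_cases h : x ∈ X <;> simp [h]
    | @add f g _ hf hg =>
      exact hp.add _ _ (boundedMeasurable_simpleFunc f) (boundedMeasurable_simpleFunc g) hf hg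

theorem BoundedClosed.indicator_compl {p : (α → ℂ) → Prop} (hp : BoundedClosed p) {X : Set α}
    (hX : MeasurableSet X) (h1 : p 1) (h : p (X.indicator 1)) : p (Xᶜ.indicator 1) := by
  have hbX := boundedMeasurable_indicator hX
  rw [Set.indicator_compl, sub_eq_add_neg, ← neg_one_smul ℂ (X.indicator (1 : α → ℂ))]
  exact hp.add _ _ boundedMeasurable_one (hbX.smul (-1)) h1 (hp.smul _ _ hbX h)

theorem BoundedClosed.indicator_iUnion {p : (α → ℂ) → Prop} (hp : BoundedClosed p) (h0 : p 0)
    {X : ℕ → Set α} (hd : Pairwise (Function.onFun Disjoint X)) (hX : ∀ i, MeasurableSet (X i))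
    (h : ∀ i, p ((X i).indicator 1)) : p ((⋃ i, X i).indicator 1) := by
  have hm n : BoundedMeasurable ((⋃ i ∈ Finset.range n, X i).indicator (1 : α → ℂ)) :=
    boundedMeasurable_indicator (Finset.measurableSet_biUnion _ fun i _ => hX i)
  refine hp.lim _ _ hm (tendstoBoundedly_indicator_iUnion X) fun n => ?_
  induction n with
  | zero => simpa [Pi.zero_def] using h0
  | succ n ih =>
    have hdis : Disjoint (X n) (⋃ i ∈ Finset.range n, X i) :=
      Set.disjoint_iUnion₂_right.2 fun i hi => hd (Finset.mem_range.1 hi).ne'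
    rw [Finset.range_add_one, Finset.set_biUnion_insert, Set.indicator_union_of_disjoint hdis]
    exact hp.add _ _ (boundedMeasurable_indicator (hX n)) (hm n) (h n) ih

theorem isDetermining_indicator_of_generateFrom {C : Set (Set α)}
    (hgen : ‹MeasurableSpace α› = MeasurableSpace.generateFrom C) (hC : IsPiSystem C)
    (huniv : Set.univ ∈ C) : IsDetermining {f : α → ℂ | ∃ X ∈ C, f = X.indicator 1} where
  boundedMeasurable := by
    rintro _ ⟨X, hX, rfl⟩
    exact boundedMeasurable_indicator (hgen ▸ .basic X hX)
  induction p hp hind := by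
    have h1 : p 1 := by simpa using hind _ ⟨_, huniv, rfl⟩
    have h0 : p 0 := by simpa using hp.smul 0 1 boundedMeasurable_one h1
    refine isDetermining_indicator.induction p hp ?_
    rintro _ ⟨X, hX, rfl⟩
    induction X, hX using MeasurableSpace.induction_on_inter hgen hC with
    | empty => simpa [Pi.zero_def] using h0
    | basic X hX => exact hind _ ⟨X, hX, rfl⟩
    | compl X hX ih => exact hp.indicator_compl hX h1 ih
    | iUnion X hd hX ih => exact hp.indicator_iUnion h0 hd hX ih

namespace IsDetermining

variable {S T : Set (α → ℂ)}

theorem of_tendstoBoundedly (hT : IsDetermining T) (hS : ∀ f ∈ S, BoundedMeasurable f)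
    (h : ∀ f ∈ T, ∃ F : ℕ → α → ℂ, (∀ n, F n ∈ S) ∧ TendstoBoundedly F f) : IsDetermining S where
  boundedMeasurable := hS
  induction p hp hpS := by
    refine hT.induction p hp fun f hf => ?_
    obtain ⟨F, hF, hlim⟩ := h f hf
    exact hp.lim F f (fun n => hS _ (hF n)) hlim fun n => hpS _ (hF n)

theorem measure_ext (hS : IsDetermining S) {μ ν : Measure α} [IsFiniteMeasure μ]
    [IsFiniteMeasure ν] (h : ∀ f ∈ S, ∫ x, f x ∂μ = ∫ x, f x ∂ν) : μ = ν := by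
  ext X hX
  have := hS.induction _ (boundedClosed_integral_eq μ ν) h _ (boundedMeasurable_indicator hX)
  simp only [integral_indicator_one_complex _ hX] at this
  exact (measureReal_eq_measureReal_iff).1 (by exact_mod_cast this)

end IsDetermining

end BoundedMeasurable

section ZeroAtInfty

variable {Ω : Type*} [TopologicalSpace Ω]

/-- Composition of a function vanishing at infinity with a continuous function fixing zero. -/
def postcompZeroAtInfty (φ : C(ℂ, ℂ)) (hφ : φ 0 = 0) (f : C₀(Ω, ℂ)) : C₀(Ω, ℂ) where
  toContinuousMap := φ.comp f.toContinuousMap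
  zero_at_infty' := by
    have := (φ.continuous.tendsto 0).comp f.zero_at_infty'
    rwa [hφ] at this

theorem exists_nonneg_decomposition (f : C₀(Ω, ℂ)) :
    ∃ a b c d : C₀(Ω, ℂ), (∀ x, 0 ≤ a x) ∧ (∀ x, 0 ≤ b x) ∧ (∀ x, 0 ≤ c x) ∧ (∀ x, 0 ≤ d x) ∧
      f = a - b + Complex.I • (c - d) := by
  let part (r : C(ℂ, ℝ)) : C(ℂ, ℂ) := ⟨fun z => ((r z)⁺ : ℝ), by fun_prop⟩
  have part_nonneg (r : C(ℂ, ℝ)) (z : ℂ) : 0 ≤ part r z := by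
    simp [part]
  let re : C(ℂ, ℝ) := ⟨Complex.re, Complex.continuous_re⟩
  let im : C(ℂ, ℝ) := ⟨Complex.im, Complex.continuous_im⟩
  refine ⟨postcompZeroAtInfty (part re) (by simp [part, re]) f,
    postcompZeroAtInfty (part (-re)) (by simp [part, re]) f,
    postcompZeroAtInfty (part im) (by simp [part, im]) f,
    postcompZeroAtInfty (part (-im)) (by simp [part, im]) f,
    fun x => part_nonneg _ _, fun x => part_nonneg _ _, fun x => part_nonneg _ _,
    fun x => part_nonneg _ _, ?_⟩
  have part_sub (r : C(ℂ, ℝ)) (z : ℂ) : part r z - part (-r) z = r z := by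
    simp [part, ← Complex.ofReal_sub, posPart_sub_negPart]
  ext x
  calc f x = (re (f x) : ℂ) + Complex.I * (im (f x) : ℂ) := by
        rw [mul_comm]; exact (Complex.re_add_im _).symm
    _ = part re (f x) - part (-re) (f x) +
        Complex.I * (part im (f x) - part (-im) (f x)) := by rw [part_sub, part_sub]

/-- The complexification of a real compactly supported function, as a function vanishing at
infinity. It transfers the Riesz theorem from `C_c(Ω, ℝ)` to `C₀(Ω, ℂ)`. -/
def toComplexZeroAtInfty : C_c(Ω, ℝ) →ₗ[ℝ] C₀(Ω, ℂ) where
  toFun f :=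
    { toFun := fun x => (f x : ℂ)
      continuous_toFun := Complex.continuous_ofReal.comp f.continuous
      zero_at_infty' :=
        (f.hasCompactSupport.comp_left (g := ((↑) : ℝ → ℂ)) Complex.ofReal_zero).is_zero_at_infty }
  map_add' f g := by ext x; simp
  map_smul' c f := by ext x; simp

@[simp]
theorem toComplexZeroAtInfty_apply (f : C_c(Ω, ℝ)) (x : Ω) :
    toComplexZeroAtInfty f x = (f x : ℂ) := rfl

theorem hasCompactSupport_comp_zeroAtInfty [T2Space Ω] (f : C₀(Ω, ℂ)) {φ : ℂ → ℝ}
    (hφ : φ =ᶠ[𝓝 0] 0) : HasCompactSupport (φ ∘ f) := by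
  rw [hasCompactSupport_iff_eventuallyEq, coclosedCompact_eq_cocompact]
  exact f.zero_at_infty'.eventually hφ

theorem exists_compactlySupported_sub_le [T2Space Ω] {f : C₀(Ω, ℂ)} (hf : ∀ x, 0 ≤ f x) {ε : ℝ}
    (hε : 0 < ε) :
    ∃ g : C_c(Ω, ℝ), (∀ x, 0 ≤ g x) ∧ ∀ x, 0 ≤ f x - g x ∧ f x - g x ≤ ε := by
  let φ : ℂ → ℝ := fun z => (z.re - ε)⁺
  have hφ : φ =ᶠ[𝓝 0] 0 := by
    filter_upwards [(Complex.continuous_re.tendsto 0).eventually_lt_const hε] with z hz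
    exact posPart_eq_zero.2 (by linarith)
  refine ⟨⟨⟨φ ∘ f, ?_⟩, hasCompactSupport_comp_zeroAtInfty f hφ⟩,
    fun x => posPart_nonneg _, fun x => ?_⟩
  · have := map_continuous f
    fun_prop
  obtain ⟨r, hr⟩ : ∃ r : ℝ, (r : ℂ) = f x := ⟨_, (Complex.eq_re_of_ofReal_le (hf x)).symm⟩
  have hr0 : 0 ≤ r := by exact_mod_cast hr ▸ hf x
  change 0 ≤ f x - (φ (f x) : ℂ) ∧ f x - (φ (f x) : ℂ) ≤ ε
  have h1 : φ r ≤ r := sup_le (by simpa using hε.le) hr0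
  have h2 : r - ε ≤ φ r := le_posPart _
  rw [← hr]
  exact_mod_cast And.intro (sub_nonneg.2 h1) (by linarith)

/-- The positive functionals on `C₀(Ω, ℂ)` of total mass at most `C`, without reference to an order
or a norm on `C₀(Ω, ℂ)`: these are the functionals representable by a measure of mass `≤ C`. -/
structure IsPositiveOfMassLE (Λ : C₀(Ω, ℂ) →ₗ[ℂ] ℂ) (C : ℝ) : Prop where
  nonneg : ∀ f : C₀(Ω, ℂ), (∀ x, 0 ≤ f x) → 0 ≤ Λ f
  le : ∀ f : C₀(Ω, ℂ), (∀ x, 0 ≤ f x) → (∀ x, f x ≤ 1) → Λ f ≤ C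

namespace IsPositiveOfMassLE

variable {Λ Λ' : C₀(Ω, ℂ) →ₗ[ℂ] ℂ} {C : ℝ}

theorem norm_le (hΛ : IsPositiveOfMassLE Λ C) {f : C₀(Ω, ℂ)} {ε : ℝ} (hε : 0 < ε)
    (hf : ∀ x, 0 ≤ f x) (hfε : ∀ x, f x ≤ ε) : ‖Λ f‖ ≤ ε * C := by
  have hε' : (0 : ℂ) ≤ (ε : ℂ)⁻¹ := by exact_mod_cast (inv_pos.2 hε).le
  have hne : (ε : ℂ) ≠ 0 := by exact_mod_cast hε.ne'
  set g := (ε : ℂ)⁻¹ • f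
  have hg0 x : 0 ≤ g x := mul_nonneg hε' (hf x)
  have hg1 x : g x ≤ 1 :=
    (mul_le_mul_of_nonneg_left (hfε x) hε').trans_eq (inv_mul_cancel₀ hne)
  have hC : (0 : ℂ) ≤ C := (hΛ.nonneg g hg0).trans (hΛ.le g hg0 hg1)
  calc ‖Λ f‖ = ‖(ε : ℂ) • Λ g‖ := by rw [← map_smul, smul_inv_smul₀ hne]
    _ = ε * ‖Λ g‖ := by rw [norm_smul, Complex.norm_of_nonneg hε.le]
    _ ≤ ε * ‖(C : ℂ)‖ := by
      gcongr
      exact CStarAlgebra.norm_le_norm_of_nonneg_of_le (hΛ.nonneg g hg0) (hΛ.le g hg0 hg1)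
    _ = ε * C := by rw [Complex.norm_of_nonneg (by exact_mod_cast hC)]

theorem ext_of_compactlySupported [T2Space Ω] (hΛ : IsPositiveOfMassLE Λ C)
    (hΛ' : IsPositiveOfMassLE Λ' C)
    (h : ∀ g : C_c(Ω, ℝ), (∀ x, 0 ≤ g x) →
      Λ (toComplexZeroAtInfty g) = Λ' (toComplexZeroAtInfty g)) : Λ = Λ' := by
  have hnonneg (f : C₀(Ω, ℂ)) (hf : ∀ x, 0 ≤ f x) : Λ f = Λ' f := by
    refine eq_of_forall_dist_le fun δ hδ => ?_
    obtain ⟨ε, hε, hεδ⟩ : ∃ ε > 0, ε * (C + C) ≤ δ := exists_pos_mul_lt hδ (C + C) |>.imp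
      fun ε hε => ⟨hε.1, (mul_comm _ _).trans_le hε.2.le⟩
    obtain ⟨g, hg0, hg⟩ := exists_compactlySupported_sub_le hf hε
    set r := f - toComplexZeroAtInfty g
    have hr0 x : 0 ≤ r x := (hg x).1
    have hrε x : r x ≤ ε := (hg x).2
    calc dist (Λ f) (Λ' f) = ‖Λ r - Λ' r‖ := by
          rw [dist_eq_norm, map_sub, map_sub, h g hg0, sub_sub_sub_cancel_right]
      _ ≤ ‖Λ r‖ + ‖Λ' r‖ := norm_sub_le _ _
      _ ≤ ε * C + ε * C := add_le_add (hΛ.norm_le hε hr0 hrε) (hΛ'.norm_le hε hr0 hrε)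
      _ ≤ δ := by rwa [← mul_add]
  ext f
  obtain ⟨a, b, c, d, ha, hb, hc, hd, rfl⟩ := exists_nonneg_decomposition f
  simp only [map_add, map_sub, map_smul, hnonneg a ha, hnonneg b hb, hnonneg c hc, hnonneg d hd]

end IsPositiveOfMassLE

variable [MeasurableSpace Ω] [OpensMeasurableSpace Ω]

/-- Integration of functions vanishing at infinity against a finite measure, as a functional. -/
def integralZeroAtInfty (μ : Measure Ω) [IsFiniteMeasure μ] : C₀(Ω, ℂ) →ₗ[ℂ] ℂ where
  toFun f := ∫ x, f x ∂μ
  map_add' f g := integral_add ((boundedMeasurable_zeroAtInfty f).integrable μ)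
    ((boundedMeasurable_zeroAtInfty g).integrable μ)
  map_smul' c f := integral_smul c f

theorem isPositiveOfMassLE_integralZeroAtInfty (μ : Measure Ω) [IsFiniteMeasure μ] {C : ℝ}
    (hC : μ.real Set.univ ≤ C) : IsPositiveOfMassLE (integralZeroAtInfty μ) C where
  nonneg _ hf := integral_nonneg hf
  le f _ hf := calc ∫ x, f x ∂μ
    _ ≤ ∫ _, 1 ∂μ :=
      integral_mono ((boundedMeasurable_zeroAtInfty f).integrable μ) (integrable_const 1) hf
    _ ≤ C := by simpa using hC

end ZeroAtInfty

section Riesz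

variable {Ω : Type*} [TopologicalSpace Ω] [T2Space Ω] [LocallyCompactSpace Ω] [MeasurableSpace Ω]
  [BorelSpace Ω]

theorem rieszMeasure_univ_le {Λ : C_c(Ω, ℝ) →ₚ[ℝ] ℝ} {C : ℝ}
    (hC : ∀ f : C_c(Ω, ℝ), (∀ x, f x ∈ Set.Icc 0 1) → Λ f ≤ C) :
    RealRMK.rieszMeasure Λ Set.univ ≤ ENNReal.ofReal C := by
  rw [isOpen_univ.measure_eq_iSup_isCompact]
  refine iSup₂_le fun K _ => iSup_le fun hK => ?_
  obtain ⟨f, hfK, -, hf, hfI⟩ :=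
    exists_continuous_one_zero_of_isCompact hK isClosed_empty (Set.disjoint_empty K)
  let g : C_c(Ω, ℝ) := ⟨f, hf⟩
  exact (RealRMK.rieszMeasure_le_of_eq_one Λ (f := g) (fun x => (hfI x).1) hK hfK).trans
    (ENNReal.ofReal_le_ofReal (hC g hfI))

theorem IsPositiveOfMassLE.exists_measure {Λ : C₀(Ω, ℂ) →ₗ[ℂ] ℂ} {C : ℝ}
    (hΛ : IsPositiveOfMassLE Λ C) :
    ∃ μ : Measure Ω, μ Set.univ ≤ ENNReal.ofReal C ∧ ∀ f : C₀(Ω, ℂ), Λ f = ∫ x, f x ∂μ := by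
  let Λr : C_c(Ω, ℝ) →ₚ[ℝ] ℝ := PositiveLinearMap.mk₀
    (Complex.reLm ∘ₗ Λ.restrictScalars ℝ ∘ₗ toComplexZeroAtInfty)
    (fun f hf => (Complex.nonneg_iff.1 (hΛ.nonneg _ fun x => by simpa using hf x)).1)
  let μ := RealRMK.rieszMeasure Λr
  have hmass : μ Set.univ ≤ ENNReal.ofReal C := rieszMeasure_univ_le fun f hf =>
    (Complex.le_def.1 (hΛ.le (toComplexZeroAtInfty f) (fun x => by simpa using (hf x).1)
      (fun x => by simpa using Complex.real_le_real.2 (hf x).2))).1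
  have : IsFiniteMeasure μ := ⟨hmass.trans_lt ENNReal.ofReal_lt_top⟩
  have hC : 0 ≤ C := by simpa using hΛ.le 0 (fun _ => le_rfl) (fun _ => zero_le_one)
  have heq : Λ = integralZeroAtInfty μ := by
    refine hΛ.ext_of_compactlySupported (isPositiveOfMassLE_integralZeroAtInfty μ
      (ENNReal.toReal_le_of_le_ofReal hC hmass)) fun g hg => ?_
    calc Λ (toComplexZeroAtInfty g)
      _ = Λr g := Complex.eq_re_of_ofReal_le (hΛ.nonneg _ fun x => by simpa using hg x)
      _ = ∫ x, g x ∂μ := by rw [RealRMK.integral_rieszMeasure]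
      _ = integralZeroAtInfty μ (toComplexZeroAtInfty g) := integral_complex_ofReal.symm
  exact ⟨μ, hmass, fun f => DFunLike.congr_fun heq f⟩

end Riesz

section Determining

variable {Ω : Type*} [TopologicalSpace Ω] [T2Space Ω] [LocallyCompactSpace Ω]
  [SecondCountableTopology Ω]

theorem exists_zeroAtInfty_tendstoBoundedly_indicator {U : Set Ω} (hU : IsOpen U) :
    ∃ f : ℕ → C₀(Ω, ℂ), TendstoBoundedly (fun n => f n) (U.indicator 1) := by
  let := TopologicalSpace.metrizableSpaceMetric Ω
  obtain ⟨F, hF, hFU, hUn, hmono⟩ := hU.exists_iUnion_isClosed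
  have hK n : IsCompact (compactCovering Ω n ∩ F n) :=
    (isCompact_compactCovering Ω n).inter_right (hF n)
  have hd n : Disjoint (compactCovering Ω n ∩ F n) Uᶜ :=
    Set.disjoint_compl_right_iff_subset.2 (Set.inter_subset_right.trans (hFU n))
  choose f hf1 hf0 hfs hfI using fun n =>
    exists_continuous_one_zero_of_isCompact (hK n) hU.isClosed_compl (hd n)
  refine ⟨fun n => toComplexZeroAtInfty ⟨f n, hfs n⟩, ⟨1, fun n x => ?_⟩, fun x => ?_⟩
  · simpa [abs_of_nonneg (hfI n x).1] using (hfI n x).2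
  by_cases hx : x ∈ U
  · obtain ⟨m, hm⟩ := Set.mem_iUnion.1 (hUn ▸ hx)
    obtain ⟨k, hk⟩ := exists_mem_compactCovering x
    refine tendsto_const_nhds.congr' ?_
    filter_upwards [eventually_ge_atTop (max m k)] with n hn
    have hxn : x ∈ compactCovering Ω n ∩ F n :=
      ⟨compactCovering_subset Ω ((le_max_right m k).trans hn) hk,
        hmono ((le_max_left m k).trans hn) hm⟩
    simp [hx, hf1 n hxn]
  · refine tendsto_const_nhds.congr fun n => ?_
    simp [hx, hf0 n hx]

theorem isDetermining_zeroAtInfty [MeasurableSpace Ω] [BorelSpace Ω] :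
    IsDetermining (Set.range fun f : C₀(Ω, ℂ) => (f : Ω → ℂ)) := by
  refine (isDetermining_indicator_of_generateFrom BorelSpace.measurable_eq isPiSystem_isOpen
    isOpen_univ).of_tendstoBoundedly ?_ ?_
  · rintro _ ⟨f, rfl⟩
    exact boundedMeasurable_zeroAtInfty f
  · rintro _ ⟨U, hU, rfl⟩
    obtain ⟨f, hf⟩ := exists_zeroAtInfty_tendstoBoundedly_indicator hU
    exact ⟨_, fun n => ⟨f n, rfl⟩, hf⟩

theorem isDetermining_continuousMap [CompactSpace Ω] [MeasurableSpace Ω] [BorelSpace Ω] :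
    IsDetermining (Set.range fun f : C(Ω, ℂ) => (f : Ω → ℂ)) where
  boundedMeasurable := by
    rintro _ ⟨f, rfl⟩
    exact boundedMeasurable_continuousMap f
  induction p hp h := isDetermining_zeroAtInfty.induction p hp <| by
    rintro _ ⟨f, rfl⟩
    exact h _ ⟨f.toContinuousMap, rfl⟩

end Determining

namespace SubprobabilityMeasure

variable {Ω : Type*} [MeasurableSpace Ω]

instance (μ : SubprobabilityMeasure Ω) : IsFiniteMeasure μ.toMeasure :=
  ⟨μ.measure_univ_le_one.trans_lt ENNReal.one_lt_top⟩

theorem toMeasure_injective :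
    Function.Injective (toMeasure : SubprobabilityMeasure Ω → Measure Ω) := by
  rintro ⟨μ, _⟩ ⟨ν, _⟩ rfl
  rfl

theorem real_univ_le_one (μ : SubprobabilityMeasure Ω) : μ.toMeasure.real Set.univ ≤ 1 :=
  ENNReal.toReal_le_of_le_ofReal zero_le_one (by simpa using μ.measure_univ_le_one)

theorem norm_integral_le (μ : SubprobabilityMeasure Ω) {f : Ω → ℂ} {C : ℝ} (hC0 : 0 ≤ C)
    (hC : ∀ x, ‖f x‖ ≤ C) : ‖∫ x, f x ∂μ.toMeasure‖ ≤ C :=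
  (norm_integral_le_of_norm_le_const (ae_of_all _ hC)).trans
    (mul_le_of_le_one_right hC0 μ.real_univ_le_one)

/-- The function `μ ↦ μ(f) = ∫ f dμ` on `B(Ω)⁺`, the integrand of the representations. -/
def eval (f : Ω → ℂ) (μ : SubprobabilityMeasure Ω) : ℂ :=
  ∫ x, f x ∂μ.toMeasure

theorem eval_add {f g : Ω → ℂ} (hf : BoundedMeasurable f) (hg : BoundedMeasurable g) :
    eval (f + g) = eval f + eval g :=
  funext fun _ => integral_add (hf.integrable _) (hg.integrable _)

theorem eval_smul (c : ℂ) (f : Ω → ℂ) : eval (c • f) = c • eval f :=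
  funext fun _ => integral_smul c f

theorem eval_indicator {X : Set Ω} (hX : MeasurableSet X) :
    eval (X.indicator 1) = fun μ : SubprobabilityMeasure Ω => ((μ.toMeasure.real X : ℝ) : ℂ) :=
  funext fun _ => integral_indicator_one_complex _ hX

theorem tendstoBoundedly_eval {F : ℕ → Ω → ℂ} {f : Ω → ℂ} (hF : ∀ n, BoundedMeasurable (F n))
    (h : TendstoBoundedly F f) : TendstoBoundedly (fun n => eval (F n)) (eval f) := by
  obtain ⟨C, hC⟩ := h.bounded
  exact ⟨⟨|C|, fun n μ => μ.norm_integral_le (abs_nonneg C) fun x =>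
    (hC n x).trans (le_abs_self C)⟩, fun μ => h.integral hF μ.toMeasure⟩

theorem mem_probabilityMeasures_iff_eval_one (μ : SubprobabilityMeasure Ω) :
    μ ∈ probabilityMeasures Ω ↔ eval 1 μ = 1 := by
  rw [← Set.indicator_univ (1 : Ω → ℂ), eval_indicator .univ, Complex.ofReal_eq_one,
    measureReal_def, ENNReal.toReal_eq_one_iff]
  rfl

variable [TopologicalSpace Ω]

theorem isInducing_eval :
    Topology.IsInducing fun (μ : SubprobabilityMeasure Ω) (f : C₀(Ω, ℂ)) => eval f μ :=
  ⟨rfl⟩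

/-- The functions `μ ↦ μ(f)` with `f ∈ C₀(Ω)` as elements of the C⋆-algebra `C(B(Ω)⁺, ℂ)`. -/
def evalMap (f : C₀(Ω, ℂ)) : C(SubprobabilityMeasure Ω, ℂ) :=
  ⟨eval f, (continuous_apply f).comp isInducing_eval.continuous⟩

variable [T2Space Ω] [LocallyCompactSpace Ω] [BorelSpace Ω]

theorem exists_eval_eq_iff (Λ : C₀(Ω, ℂ) →ₗ[ℂ] ℂ) :
    (∃ μ : SubprobabilityMeasure Ω, ∀ f : C₀(Ω, ℂ), eval f μ = Λ f) ↔
      IsPositiveOfMassLE Λ 1 := by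
  constructor
  · rintro ⟨μ, hμ⟩
    rw [← show integralZeroAtInfty μ.toMeasure = Λ from LinearMap.ext hμ]
    exact isPositiveOfMassLE_integralZeroAtInfty _ μ.real_univ_le_one
  · intro hΛ
    obtain ⟨μ, hμ, h⟩ := hΛ.exists_measure
    exact ⟨⟨μ, by simpa using hμ⟩, fun f => (h f).symm⟩

theorem isClosed_range_eval : IsClosed (Set.range
    fun (μ : SubprobabilityMeasure Ω) (f : C₀(Ω, ℂ)) => eval f μ) := by
  have hrange : (Set.range fun (μ : SubprobabilityMeasure Ω) (f : C₀(Ω, ℂ)) => eval f μ) =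
      Set.range ((↑) : (C₀(Ω, ℂ) →ₗ[ℂ] ℂ) → C₀(Ω, ℂ) → ℂ) ∩
        {Λ | (∀ f : C₀(Ω, ℂ), (∀ x, 0 ≤ f x) → 0 ≤ Λ f) ∧
          ∀ f : C₀(Ω, ℂ), (∀ x, 0 ≤ f x) → (∀ x, f x ≤ 1) → Λ f ≤ 1} := by
    ext Λ
    constructor
    · rintro ⟨μ, rfl⟩
      have h := isPositiveOfMassLE_integralZeroAtInfty _ μ.real_univ_le_one
      exact ⟨⟨integralZeroAtInfty μ.toMeasure, rfl⟩, h.nonneg,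
        fun f hf hf1 => (h.le f hf hf1).trans_eq Complex.ofReal_one⟩
    · rintro ⟨⟨Λ, rfl⟩, hnonneg, hle⟩
      exact ((exists_eval_eq_iff Λ).2 ⟨hnonneg, by simpa using hle⟩).imp fun _ => funext
  rw [hrange]
  simp only [Set.ofPred_and, Set.ofPred_forall]
  refine (LinearMap.isClosed_range_coe _ _ _).inter (IsClosed.inter ?_ ?_)
  · exact isClosed_iInter fun f => isClosed_iInter fun _ =>
      isClosed_le continuous_const (continuous_apply f)
  · exact isClosed_iInter fun f => isClosed_iInter fun _ => isClosed_iInter fun _ =>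
      isClosed_le (continuous_apply f) continuous_const

instance : CompactSpace (SubprobabilityMeasure Ω) := by
  refine ⟨isInducing_eval.isCompact_iff.2 ?_⟩
  rw [Set.image_univ]
  refine (isCompact_univ_pi fun f : C₀(Ω, ℂ) =>
    isCompact_closedBall (0 : ℂ) ‖f‖).of_isClosed_subset isClosed_range_eval ?_
  rintro _ ⟨μ, rfl⟩ f -
  exact mem_closedBall_zero_iff.2 (μ.norm_integral_le (norm_nonneg f) f.toBCF.norm_coe_le_norm)

variable [SecondCountableTopology Ω]

theorem ext_of_eval_eq {μ ν : SubprobabilityMeasure Ω}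
    (h : ∀ f : C₀(Ω, ℂ), eval f μ = eval f ν) : μ = ν :=
  toMeasure_injective (isDetermining_zeroAtInfty.measure_ext (by rintro _ ⟨f, rfl⟩; exact h f))

instance : T2Space (SubprobabilityMeasure Ω) :=
  .of_injective_continuous (fun _ _ h => ext_of_eval_eq (congrFun h))
    isInducing_eval.continuous

end SubprobabilityMeasure

section Countable

variable {Ω : Type*} [TopologicalSpace Ω] [LocallyCompactSpace Ω] [SecondCountableTopology Ω]

-- The compact-open topology is second countable, and on a ball it refines bounded convergence.
theorem exists_countable_tendstoBoundedly_of_norm_le (C : ℝ) :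
    ∃ D : Set C₀(Ω, ℂ), D.Countable ∧ ∀ f : C₀(Ω, ℂ), ‖f‖ ≤ C →
      ∃ u : ℕ → C₀(Ω, ℂ), (∀ n, u n ∈ D) ∧ TendstoBoundedly (fun n => u n) f := by
  let T := {f : C₀(Ω, ℂ) // ‖f‖ ≤ C}
  let j : T → C(Ω, ℂ) := fun f => f.1.toContinuousMap
  let : TopologicalSpace T := .induced j inferInstance
  have hj : Topology.IsInducing j := ⟨rfl⟩
  have : SecondCountableTopology T := hj.secondCountableTopology
  obtain ⟨D, hD, hDd⟩ := TopologicalSpace.exists_countable_dense T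
  refine ⟨Subtype.val '' D, hD.image _, fun f hf => ?_⟩
  obtain ⟨u, huD, hu⟩ := mem_closure_iff_seq_limit.1 (hDd ⟨f, hf⟩)
  refine ⟨fun n => (u n).1, fun n => ⟨u n, huD n, rfl⟩,
    ⟨C, fun n x => ((u n).1.toBCF.norm_coe_le_norm x).trans (u n).2⟩, fun x => ?_⟩
  exact (((continuous_eval_const x : Continuous fun g : C(Ω, ℂ) => g x).comp
    hj.continuous).tendsto _).comp hu

theorem exists_countable_isDetermining [T2Space Ω] [MeasurableSpace Ω] [BorelSpace Ω] :
    ∃ D : Set C₀(Ω, ℂ), D.Countable ∧ IsDetermining ((fun f : C₀(Ω, ℂ) => (f : Ω → ℂ)) '' D) := by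
  choose D hD hlim using fun n : ℕ =>
    exists_countable_tendstoBoundedly_of_norm_le (Ω := Ω) (n : ℝ)
  refine ⟨⋃ n, D n, Set.countable_iUnion hD,
    isDetermining_zeroAtInfty.of_tendstoBoundedly ?_ ?_⟩
  · rintro _ ⟨f, -, rfl⟩
    exact boundedMeasurable_zeroAtInfty f
  · rintro _ ⟨f, rfl⟩
    obtain ⟨n, hn⟩ := exists_nat_ge ‖f‖
    obtain ⟨u, hu, hf⟩ := hlim n f hn
    exact ⟨_, fun k => ⟨u k, Set.mem_iUnion_of_mem n (hu k), rfl⟩, hf⟩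

end Countable

namespace SubprobabilityMeasure

variable {Ω : Type*} [TopologicalSpace Ω] [T2Space Ω] [LocallyCompactSpace Ω]
  [SecondCountableTopology Ω] [MeasurableSpace Ω] [BorelSpace Ω]

-- Evaluations at a countable determining set embed the compact space `B(Ω)⁺` into `ℂ^ℕ`.
instance : SecondCountableTopology (SubprobabilityMeasure Ω) := by
  obtain ⟨D, hD, hdet⟩ := exists_countable_isDetermining (Ω := Ω)
  have : Countable D := hD
  have hcont : Continuous fun (μ : SubprobabilityMeasure Ω) (f : D) => eval f.1 μ :=
    continuous_pi fun f => (evalMap f.1).continuous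
  refine (hcont.isClosedEmbedding fun μ ν h => ?_).isEmbedding.secondCountableTopology
  refine toMeasure_injective (hdet.measure_ext ?_)
  rintro _ ⟨f, hf, rfl⟩
  exact congrFun h ⟨f, hf⟩

theorem boundedMeasurable_eval {f : Ω → ℂ} (hf : BoundedMeasurable f) :
    BoundedMeasurable (eval f) := by
  refine isDetermining_zeroAtInfty.induction (fun f => BoundedMeasurable (eval f))
    ⟨fun f g hf hg hfp hgp => ?_, fun c f _ hfp => ?_, fun F f hF hlim hFp => ?_⟩ ?_ f hf
  · exact eval_add hf hg ▸ hfp.add hgp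
  · exact eval_smul c f ▸ hfp.smul c
  · exact (tendstoBoundedly_eval hF hlim).boundedMeasurable hFp
  · rintro _ ⟨f, rfl⟩
    exact boundedMeasurable_continuousMap (evalMap f)

theorem measurableSet_probabilityMeasures : MeasurableSet (probabilityMeasures Ω) := by
  have hset : probabilityMeasures Ω = eval 1 ⁻¹' {1} :=
    Set.ext mem_probabilityMeasures_iff_eval_one
  rw [hset]
  exact (boundedMeasurable_eval boundedMeasurable_one).measurable (measurableSet_singleton 1)

theorem ae_mem_probabilityMeasures {m : Measure (SubprobabilityMeasure Ω)} [IsFiniteMeasure m]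
    (h : ∫ μ, eval 1 μ ∂m = ∫ _, 1 ∂m) : ∀ᵐ μ ∂m, μ ∈ probabilityMeasures Ω := by
  have heval : eval 1 = fun μ : SubprobabilityMeasure Ω => (μ.toMeasure.real Set.univ : ℂ) := by
    rw [← eval_indicator .univ, Set.indicator_univ]
  have hint : Integrable (fun μ : SubprobabilityMeasure Ω => μ.toMeasure.real Set.univ) m := by
    simpa only [heval] using! ((boundedMeasurable_eval boundedMeasurable_one).integrable m).re
  have heq : ∫ μ : SubprobabilityMeasure Ω, μ.toMeasure.real Set.univ ∂m = ∫ _, 1 ∂m := by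
    rw [heval, integral_complex_ofReal] at h
    exact Complex.ofReal_injective (by simpa using h)
  filter_upwards [(integral_eq_iff_of_ae_le hint (integrable_const 1)
    (ae_of_all _ real_univ_le_one)).1 heq] with μ hμ
  simp only [mem_probabilityMeasures_iff_eval_one, heval, hμ, Complex.ofReal_one]

theorem eq_top_of_evalMap_mem {S : StarSubalgebra ℂ C(SubprobabilityMeasure Ω, ℂ)}
    (hclosed : IsClosed (S : Set C(SubprobabilityMeasure Ω, ℂ)))
    (hS : ∀ f : C₀(Ω, ℂ), evalMap f ∈ S) : S = ⊤ := by
  have hsep : S.SeparatesPoints := by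
    intro μ ν hμν
    by_contra! h
    exact hμν (ext_of_eval_eq fun f => h _ ⟨evalMap f, hS f, rfl⟩)
  rw [← top_le_iff,
    ← ContinuousMap.starSubalgebra_topologicalClosure_eq_top_of_separatesPoints S hsep]
  exact StarSubalgebra.topologicalClosure_minimal le_rfl hclosed

end SubprobabilityMeasure

section WeakOperatorLimits

variable {H : Type*} [NormedAddCommGroup H] [InnerProductSpace ℂ H] {ι : Type*} {l : Filter ι}

theorem ext_of_inner_self {A B : H →L[ℂ] H} (h : ∀ ψ, ⟪ψ, A ψ⟫_ℂ = ⟪ψ, B ψ⟫_ℂ) : A = B :=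
  ContinuousLinearMap.coe_injective <| (ext_inner_map _ _).1 fun ψ => by
    simpa only [inner_conj_symm, ContinuousLinearMap.coe_coe] using
      congrArg (starRingEnd ℂ) (h ψ)

theorem isPositive_of_inner_self_nonneg [CompleteSpace H] {A : H →L[ℂ] H}
    (h : ∀ ψ, 0 ≤ ⟪ψ, A ψ⟫_ℂ) : A.IsPositive := by
  refine (ContinuousLinearMap.isPositive_iff' A).2 ⟨ext_of_inner_self fun ψ => ?_, fun ψ => ?_⟩
  · rw [ContinuousLinearMap.star_eq_adjoint, ContinuousLinearMap.adjoint_inner_right,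
      ← inner_conj_symm]
    exact Complex.conj_eq_iff_im.2 (Complex.nonneg_iff.1 (h ψ)).2.symm
  · rw [← inner_conj_symm]
    exact star_nonneg_iff.2 (h ψ)

theorem tendsto_inner_swap {φ ψ : ι → H} {c : ℂ} (h : Tendsto (fun i => ⟪φ i, ψ i⟫_ℂ) l (𝓝 c)) :
    Tendsto (fun i => ⟪ψ i, φ i⟫_ℂ) l (𝓝 (starRingEnd ℂ c)) :=
  ((Complex.continuous_conj.tendsto c).comp h).congr fun _ => inner_conj_symm _ _

theorem tendsto_inner_polarization {A : ι → H →L[ℂ] H} {q : H → ℂ}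
    (h : ∀ ψ, Tendsto (fun i => ⟪A i ψ, ψ⟫_ℂ) l (𝓝 (q ψ))) (φ ψ : H) :
    Tendsto (fun i => ⟪A i ψ, φ⟫_ℂ) l (𝓝 ((q (φ + ψ) - q (φ - ψ)
      + Complex.I * q (φ + Complex.I • ψ) - Complex.I * q (φ - Complex.I • ψ)) / 4)) :=
  Tendsto.congr (fun i => (inner_map_polarization (A i : H →ₗ[ℂ] H) φ ψ).symm)
    (((((h (φ + ψ)).sub (h (φ - ψ))).add ((h (φ + Complex.I • ψ)).const_mul Complex.I)).sub
      ((h (φ - Complex.I • ψ)).const_mul Complex.I)).div_const 4)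

theorem tendsto_inner_of_tendsto_inner_self {A : ι → H →L[ℂ] H} {B : H →L[ℂ] H}
    (h : ∀ ψ, Tendsto (fun i => ⟪ψ, A i ψ⟫_ℂ) l (𝓝 ⟪ψ, B ψ⟫_ℂ)) (φ ψ : H) :
    Tendsto (fun i => ⟪φ, A i ψ⟫_ℂ) l (𝓝 ⟪φ, B ψ⟫_ℂ) := by
  have hswap ψ : Tendsto (fun i => ⟪A i ψ, ψ⟫_ℂ) l (𝓝 ⟪B ψ, ψ⟫_ℂ) :=
    inner_conj_symm (𝕜 := ℂ) (B ψ) ψ ▸ tendsto_inner_swap (h ψ)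
  rw [← inner_conj_symm, ← ContinuousLinearMap.coe_coe B,
    inner_map_polarization (B : H →ₗ[ℂ] H) φ ψ]
  exact tendsto_inner_swap (tendsto_inner_polarization hswap φ ψ)

theorem hasSum_inner_iUnion {α : Type*} [MeasurableSpace α] {μ : H → Measure α}
    [∀ ψ, IsFiniteMeasure (μ ψ)] {A : Set α → H →L[ℂ] H}
    (hA : ∀ X, MeasurableSet X → ∀ ψ, ⟪ψ, A X ψ⟫_ℂ = (((μ ψ).real X : ℝ) : ℂ))
    {X : ℕ → Set α} (hX : ∀ i, MeasurableSet (X i)) (hd : Pairwise (Function.onFun Disjoint X))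
    (φ ψ : H) : HasSum (fun i => ⟪φ, A (X i) ψ⟫_ℂ) ⟪φ, A (⋃ i, X i) ψ⟫_ℂ := by
  have hself ψ : HasSum (fun i => ⟪ψ, A (X i) ψ⟫_ℂ) ⟪ψ, A (⋃ i, X i) ψ⟫_ℂ := by
    simp only [hA _ (hX _), hA _ (.iUnion hX), Complex.hasSum_ofReal]
    simpa only [Measure.toSignedMeasure_apply_measurable, hX, MeasurableSet.iUnion hX] using
      (μ ψ).toSignedMeasure.m_iUnion hX hd
  have hsum φ ψ (s : Finset ℕ) :
      ⟪φ, (∑ i ∈ s, A (X i)) ψ⟫_ℂ = ∑ i ∈ s, ⟪φ, A (X i) ψ⟫_ℂ := by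
    rw [sum_apply, inner_sum]
  have hlim ψ : Tendsto (fun s : Finset ℕ => ⟪ψ, (∑ i ∈ s, A (X i)) ψ⟫_ℂ) atTop
      (𝓝 ⟪ψ, A (⋃ i, X i) ψ⟫_ℂ) := Tendsto.congr (fun s => (hsum ψ ψ s).symm) (hself ψ)
  exact Tendsto.congr (hsum φ ψ) (tendsto_inner_of_tendsto_inner_self hlim φ ψ)

variable [CompleteSpace H] {A : ℕ → H →L[ℂ] H} {b : H → H → ℂ}

theorem exists_norm_le_of_tendsto_inner
    (hb : ∀ φ ψ, Tendsto (fun n => ⟪A n ψ, φ⟫_ℂ) atTop (𝓝 (b φ ψ))) : ∃ K, ∀ n, ‖A n‖ ≤ K := by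
  refine banach_steinhaus fun ψ => ?_
  obtain ⟨K, hK⟩ : ∃ K, ∀ n, ‖InnerProductSpace.toDual ℂ H (A n ψ)‖ ≤ K :=
    banach_steinhaus fun φ => by
      obtain ⟨K, hK⟩ := (Metric.isBounded_range_of_tendsto _ (hb φ ψ)).exists_norm_le
      exact ⟨K, fun n => hK _ (Set.mem_range_self n)⟩
  exact ⟨K, fun n => by simpa only [LinearIsometryEquiv.norm_map] using hK n⟩

theorem exists_inner_eq_of_tendsto_inner
    (hb : ∀ φ ψ, Tendsto (fun n => ⟪A n ψ, φ⟫_ℂ) atTop (𝓝 (b φ ψ))) :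
    ∃ B : H →L[ℂ] H, ∀ φ ψ, ⟪B ψ, φ⟫_ℂ = b φ ψ := by
  obtain ⟨K, hK⟩ := exists_norm_le_of_tendsto_inner hb
  let B : H →ₗ⋆[ℂ] H →ₗ[ℂ] ℂ := LinearMap.mk₂'ₛₗ (starRingEnd ℂ) (RingHom.id ℂ)
    (fun ψ φ => b φ ψ)
    (fun ψ ψ' φ => tendsto_nhds_unique (hb _ _)
      (((hb φ ψ).add (hb φ ψ')).congr fun n => by rw [map_add, inner_add_left]))
    (fun c ψ φ => tendsto_nhds_unique (hb _ _)
      (((hb φ ψ).const_mul _).congr fun n => by rw [map_smul, inner_smul_left]))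
    (fun ψ φ φ' => tendsto_nhds_unique (hb _ _)
      (((hb φ ψ).add (hb φ' ψ)).congr fun n => by rw [inner_add_right]))
    (fun c ψ φ => tendsto_nhds_unique (hb _ _)
      (((hb φ ψ).const_mul _).congr fun n => by rw [inner_smul_right]; rfl))
  have hB ψ φ : ‖B ψ φ‖ ≤ K * ‖ψ‖ * ‖φ‖ := by
    refine le_of_tendsto (hb φ ψ).norm (.of_forall fun n => ?_)
    calc ‖⟪A n ψ, φ⟫_ℂ‖ ≤ ‖A n ψ‖ * ‖φ‖ := norm_inner_le_norm _ _
      _ ≤ K * ‖ψ‖ * ‖φ‖ := by gcongr; exact (A n).le_of_opNorm_le (hK n) ψ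
  exact ⟨InnerProductSpace.continuousLinearMapOfBilin (B.mkContinuous₂ K hB), fun φ ψ =>
    InnerProductSpace.continuousLinearMapOfBilin_apply _ ψ φ⟩

theorem exists_inner_self_eq_of_tendsto_inner_self {q : H → ℂ}
    (h : ∀ ψ, Tendsto (fun n => ⟪ψ, A n ψ⟫_ℂ) atTop (𝓝 (q ψ))) :
    ∃ B : H →L[ℂ] H, ∀ ψ, ⟪ψ, B ψ⟫_ℂ = q ψ := by
  have hswap ψ := tendsto_inner_swap (h ψ)
  have hlim := tendsto_inner_polarization hswap
  obtain ⟨B, hB⟩ := exists_inner_eq_of_tendsto_inner hlim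
  refine ⟨B, fun ψ => ?_⟩
  rw [← inner_conj_symm, hB, tendsto_nhds_unique (hlim ψ ψ) (hswap ψ), Complex.conj_conj]

end WeakOperatorLimits

section IsSigmaNormal

variable {α : Type*} [MeasurableSpace α] {H : Type*} [NormedAddCommGroup H]
  [InnerProductSpace ℂ H]

/-- An operator valued map on functions which, on the bounded measurable ones, is linear and carries
bounded pointwise limits of sequences to weak limits. The integral of a POVM is the model. -/
structure IsSigmaNormal (Φ : (α → ℂ) → H →L[ℂ] H) : Prop where
  add : ∀ f g, BoundedMeasurable f → BoundedMeasurable g → Φ (f + g) = Φ f + Φ g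
  smul : ∀ (c : ℂ) f, BoundedMeasurable f → Φ (c • f) = c • Φ f
  tendsto_inner : ∀ (F : ℕ → α → ℂ) f, (∀ n, BoundedMeasurable (F n)) → TendstoBoundedly F f →
    ∀ φ ψ, Tendsto (fun n => ⟪φ, Φ (F n) ψ⟫_ℂ) atTop (𝓝 ⟪φ, Φ f ψ⟫_ℂ)

variable {Φ Ψ : (α → ℂ) → H →L[ℂ] H} {S : Set (α → ℂ)} {f g : α → ℂ}

theorem IsDetermining.eq_of_isSigmaNormal (hS : IsDetermining S) (hΦ : IsSigmaNormal Φ)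
    (hΨ : IsSigmaNormal Ψ) (h : ∀ f ∈ S, Φ f = Ψ f) (hf : BoundedMeasurable f) : Φ f = Ψ f := by
  refine hS.induction (fun f => Φ f = Ψ f) ⟨fun f g hf hg ef eg => ?_, fun c f hf ef => ?_,
    fun F f hF hlim eF => ?_⟩ h f hf
  · rw [hΦ.add f g hf hg, hΨ.add f g hf hg, ef, eg]
  · rw [hΦ.smul c f hf, hΨ.smul c f hf, ef]
  · refine ext_of_inner_self fun ψ => tendsto_nhds_unique (hΦ.tendsto_inner F f hF hlim ψ ψ) ?_
    simpa only [eF] using hΨ.tendsto_inner F f hF hlim ψ ψ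

namespace IsSigmaNormal

theorem mul_right (hΦ : IsSigmaNormal Φ) (T : H →L[ℂ] H) : IsSigmaNormal fun f => Φ f * T where
  add f g hf hg := by rw [hΦ.add f g hf hg, add_mul]
  smul c f hf := by rw [hΦ.smul c f hf, smul_mul_assoc]
  tendsto_inner F f hF h φ ψ := hΦ.tendsto_inner F f hF h φ (T ψ)

theorem mul_left [CompleteSpace H] (hΦ : IsSigmaNormal Φ) (T : H →L[ℂ] H) :
    IsSigmaNormal fun f => T * Φ f where
  add f g hf hg := by rw [hΦ.add f g hf hg, mul_add]
  smul c f hf := by rw [hΦ.smul c f hf, mul_smul_comm]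
  tendsto_inner F f hF h φ ψ := by
    simpa only [ContinuousLinearMap.adjoint_inner_left, mul_apply_eq_comp] using
      hΦ.tendsto_inner F f hF h (ContinuousLinearMap.adjoint T φ) ψ

theorem comp_mul (hΦ : IsSigmaNormal Φ) (hg : BoundedMeasurable g) :
    IsSigmaNormal fun f => Φ (f * g) where
  add f₁ f₂ h₁ h₂ := by rw [add_mul, hΦ.add _ _ (h₁.mul hg) (h₂.mul hg)]
  smul c f hf := by rw [smul_mul_assoc, hΦ.smul c _ (hf.mul hg)]
  tendsto_inner F f hF h :=
    hΦ.tendsto_inner _ _ (fun n => (hF n).mul hg) (h.mul_const hg)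

theorem map_mul_of_isDetermining [CompleteSpace H] (hΦ : IsSigmaNormal Φ) (hS : IsDetermining S)
    (h : ∀ f ∈ S, ∀ g ∈ S, Φ (f * g) = Φ f * Φ g) (hf : BoundedMeasurable f)
    (hg : BoundedMeasurable g) : Φ (f * g) = Φ f * Φ g := by
  have hright g (hgS : g ∈ S) : Φ (f * g) = Φ f * Φ g :=
    hS.eq_of_isSigmaNormal (hΦ.comp_mul (hS.boundedMeasurable g hgS)) (hΦ.mul_right (Φ g))
      (fun f hfS => h f hfS g hgS) hf
  simp only [mul_comm f] at hright ⊢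
  exact hS.eq_of_isSigmaNormal (hΦ.comp_mul hf) (hΦ.mul_left (Φ f)) hright hg

theorem commute_of_isDetermining [CompleteSpace H] (hΦ : IsSigmaNormal Φ) (hS : IsDetermining S)
    {T : H →L[ℂ] H} (h : ∀ f ∈ S, Commute T (Φ f)) (hf : BoundedMeasurable f) :
    Commute T (Φ f) :=
  hS.eq_of_isSigmaNormal (hΦ.mul_left T) (hΦ.mul_right T) h hf

end IsSigmaNormal

end IsSigmaNormal

section PositiveMap

variable {K : Type*} [TopologicalSpace K] [CompactSpace K] [T2Space K] [MeasurableSpace K]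
  [BorelSpace K] {H : Type*} [NormedAddCommGroup H] [InnerProductSpace ℂ H]

theorem exists_measure_inner_self_eq (Φ : C(K, ℂ) →ₚ[ℂ] H →L[ℂ] H) (ψ : H) :
    ∃ μ : Measure K, IsFiniteMeasure μ ∧ ∀ f : C(K, ℂ), ⟪ψ, Φ f ψ⟫_ℂ = ∫ x, f x ∂μ := by
  let Λ : C₀(K, ℂ) →ₗ[ℂ] ℂ :=
    { toFun f := ⟪ψ, Φ f.toContinuousMap ψ⟫_ℂ
      map_add' f g := by
        rw [← inner_add_right, ← add_apply, ← map_add]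
        rfl
      map_smul' c f := by
        rw [RingHom.id_apply, smul_eq_mul, ← inner_smul_right, ← smul_apply, ← map_smul]
        rfl }
  have hmono {f g : C(K, ℂ)} (hfg : f ≤ g) : ⟪ψ, Φ f ψ⟫_ℂ ≤ ⟪ψ, Φ g ψ⟫_ℂ := by
    have h := ContinuousLinearMap.le_def _ _ |>.1 (OrderHomClass.mono Φ hfg)
    simpa only [sub_apply, inner_sub_right, sub_nonneg] using h.inner_nonneg_right ψ
  have hnonneg {f : C(K, ℂ)} (hf : 0 ≤ f) : 0 ≤ ⟪ψ, Φ f ψ⟫_ℂ := by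
    simpa only [map_zero, zero_apply, inner_zero_right] using hmono hf
  have hone : ⟪ψ, Φ 1 ψ⟫_ℂ = (⟪ψ, Φ 1 ψ⟫_ℂ).re :=
    Complex.ext rfl (Complex.nonneg_iff.1 (hnonneg fun _ => zero_le_one)).2.symm
  have hΛ : IsPositiveOfMassLE Λ (⟪ψ, Φ 1 ψ⟫_ℂ).re :=
    { nonneg f hf := hnonneg hf
      le f _ hf := (hmono hf).trans_eq hone }
  obtain ⟨μ, hμ, h⟩ := hΛ.exists_measure
  exact ⟨μ, ⟨hμ.trans_lt ENNReal.ofReal_lt_top⟩, fun f => h ⟨f, by simp⟩⟩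

end PositiveMap

namespace POVM

variable {α : Type*} [MeasurableSpace α] {H : Type*} [NormedAddCommGroup H]
  [InnerProductSpace ℂ H] [CompleteSpace H]

section Integral

variable (E : POVM α H) {f g : α → ℂ}

theorem inner_self_apply {X : Set α} (hX : MeasurableSet X) (ψ : H) :
    ⟪ψ, E X ψ⟫_ℂ = (((E.scalarMeasure ψ).real X : ℝ) : ℂ) := by
  have h := Complex.nonneg_iff.1 ((E.isPositive X).inner_nonneg_right ψ)
  rw [measureReal_def, scalarMeasure_apply _ _ hX, ENNReal.toReal_ofReal h.1]
  exact Complex.ext rfl h.2.symm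

theorem inner_self_integral (hf : BoundedMeasurable f) (ψ : H) :
    ⟪ψ, E.integral f ψ⟫_ℂ = ∫ x, f x ∂E.scalarMeasure ψ := by
  obtain ⟨C, hC⟩ := hf.bounded
  exact (E.isIntegral_integral hf.measurable hC ψ).2

theorem integral_eq_of_inner_self (hf : BoundedMeasurable f) {A : H →L[ℂ] H}
    (h : ∀ ψ, ⟪ψ, A ψ⟫_ℂ = ∫ x, f x ∂E.scalarMeasure ψ) : E.integral f = A :=
  ext_of_inner_self fun ψ => (E.inner_self_integral hf ψ).trans (h ψ).symm

theorem isSigmaNormal_integral : IsSigmaNormal E.integral where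
  add f g hf hg := E.integral_eq_of_inner_self (hf.add hg) fun ψ => by
    rw [add_apply, inner_add_right, E.inner_self_integral hf, E.inner_self_integral hg]
    exact (integral_add (hf.integrable _) (hg.integrable _)).symm
  smul c f hf := E.integral_eq_of_inner_self (hf.smul c) fun ψ => by
    rw [smul_apply, inner_smul_right, E.inner_self_integral hf]
    exact (integral_smul c f).symm
  tendsto_inner F f hF h := tendsto_inner_of_tendsto_inner_self fun ψ => by
    simpa only [E.inner_self_integral (hF _), E.inner_self_integral (h.boundedMeasurable hF)] using
      h.integral hF (E.scalarMeasure ψ)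

theorem integral_indicator {X : Set α} (hX : MeasurableSet X) :
    E.integral (X.indicator 1) = E X :=
  E.integral_eq_of_inner_self (boundedMeasurable_indicator hX) fun ψ => by
    rw [integral_indicator_one_complex _ hX, E.inner_self_apply hX]

theorem integral_one : E.integral 1 = 1 := by
  rw [← Set.indicator_univ (1 : α → ℂ), E.integral_indicator .univ, E.univ']

theorem integral_star (hf : BoundedMeasurable f) :
    E.integral (star f) = star (E.integral f) :=
  E.integral_eq_of_inner_self hf.star fun ψ => by
    rw [ContinuousLinearMap.star_eq_adjoint, ContinuousLinearMap.adjoint_inner_right,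
      ← inner_conj_symm, E.inner_self_integral hf]
    exact integral_conj.symm

theorem integral_nonneg (hf : BoundedMeasurable f) (h0 : ∀ x, 0 ≤ f x) : 0 ≤ E.integral f := by
  rw [ContinuousLinearMap.nonneg_iff_isPositive]
  refine isPositive_of_inner_self_nonneg fun ψ => ?_
  rw [E.inner_self_integral hf]
  exact MeasureTheory.integral_nonneg h0

variable {E} {F : POVM α H} {S : Set (α → ℂ)}

theorem ext_of_isDetermining (hS : IsDetermining S)
    (h : ∀ f ∈ S, E.integral f = F.integral f) : E = F := by
  have hEF : E.toFun = F.toFun := by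
    funext X
    by_cases hX : MeasurableSet X
    · rw [← E.integral_indicator hX, ← F.integral_indicator hX]
      exact hS.eq_of_isSigmaNormal E.isSigmaNormal_integral F.isSigmaNormal_integral h
        (boundedMeasurable_indicator hX)
    · rw [E.not_measurable' X hX, F.not_measurable' X hX]
  cases E
  cases F
  cases hEF
  rfl

theorem isSharp_of_isDetermining (hS : IsDetermining S)
    (h : ∀ f ∈ S, ∀ g ∈ S, E.integral (f * g) = E.integral f * E.integral g) : E.IsSharp := by
  intro X Y hX hY
  rw [← E.integral_indicator (hX.inter hY), ← E.integral_indicator hX, ← E.integral_indicator hY,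
    Set.inter_indicator_one]
  exact E.isSigmaNormal_integral.map_mul_of_isDetermining hS h (boundedMeasurable_indicator hX)
    (boundedMeasurable_indicator hY)

theorem IsSharp.integral_mul (hE : E.IsSharp) (hf : BoundedMeasurable f)
    (hg : BoundedMeasurable g) : E.integral (f * g) = E.integral f * E.integral g := by
  refine E.isSigmaNormal_integral.map_mul_of_isDetermining isDetermining_indicator ?_ hf hg
  rintro _ ⟨X, hX, rfl⟩ _ ⟨Y, hY, rfl⟩
  rw [← Set.inter_indicator_one, E.integral_indicator hX, E.integral_indicator hY,
    E.integral_indicator (hX.inter hY), hE X Y hX hY]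

/-- Integration of continuous functions against a sharp observable on a compact space, as a
representation of the C⋆-algebra of continuous functions. -/
def IsSharp.starAlgHom [TopologicalSpace α] [CompactSpace α] [OpensMeasurableSpace α]
    (hE : E.IsSharp) : C(α, ℂ) →⋆ₐ[ℂ] (H →L[ℂ] H) where
  toFun f := E.integral f
  map_one' := E.integral_one
  map_mul' f g := hE.integral_mul (boundedMeasurable_continuousMap f)
    (boundedMeasurable_continuousMap g)
  map_zero' := by
    simpa using E.isSigmaNormal_integral.smul 0 1 boundedMeasurable_one
  map_add' f g := E.isSigmaNormal_integral.add f g (boundedMeasurable_continuousMap f)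
    (boundedMeasurable_continuousMap g)
  commutes' c := by
    have h := E.isSigmaNormal_integral.smul c 1 boundedMeasurable_one
    rw [E.integral_one] at h
    rw [Algebra.algebraMap_eq_smul_one, Algebra.algebraMap_eq_smul_one]
    exact h
  map_star' f := E.integral_star (boundedMeasurable_continuousMap f)

theorem mem_commutant_iff [TopologicalSpace α] {T : H →L[ℂ] H} :
    T ∈ E.commutant ↔ ∀ f : C₀(α, ℂ), Commute (E.integral f) T :=
  Set.mem_centralizer_iff.trans Set.forall_mem_range

theorem star_mem_commutant [TopologicalSpace α] [OpensMeasurableSpace α] {T : H →L[ℂ] H}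
    (hT : T ∈ E.commutant) : star T ∈ E.commutant :=
  mem_commutant_iff.2 fun f => by
    have h := (mem_commutant_iff.1 hT (star f)).star_star
    rwa [← E.integral_star (boundedMeasurable_zeroAtInfty _), ZeroAtInftyContinuousMap.coe_star,
      star_star] at h

theorem IsCommutative.commute_integral [TopologicalSpace α] [OpensMeasurableSpace α]
    (hE : E.IsCommutative) (f g : C₀(α, ℂ)) : Commute (E.integral f) (E.integral g) := by
  refine E.isSigmaNormal_integral.commute_of_isDetermining isDetermining_indicator ?_
    (boundedMeasurable_zeroAtInfty g)
  rintro _ ⟨X, hX, rfl⟩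
  rw [E.integral_indicator hX]
  exact hE X hX _ ⟨f, rfl⟩

theorem IsCommutative.exists_starSubalgebra [TopologicalSpace α] [OpensMeasurableSpace α]
    (hE : E.IsCommutative) :
    ∃ S : StarSubalgebra ℂ (H →L[ℂ] H), IsClosed (S : Set (H →L[ℂ] H)) ∧
      (∀ x y : S, x * y = y * x) ∧ ∀ f : C₀(α, ℂ), E.integral f ∈ S := by
  let R : Set (H →L[ℂ] H) := Set.range fun f : C₀(α, ℂ) => E.integral f
  have : IsMulCommutative (StarAlgebra.adjoin ℂ R) := by
    refine StarAlgebra.isMulCommutative_adjoin ℂ ?_ ?_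
    · rintro _ ⟨f, rfl⟩ _ ⟨g, rfl⟩
      exact hE.commute_integral f g
    · rintro _ ⟨f, rfl⟩ _ ⟨g, rfl⟩
      rw [← E.integral_star (boundedMeasurable_zeroAtInfty g)]
      exact hE.commute_integral f (star g)
  exact ⟨(StarAlgebra.adjoin ℂ R).topologicalClosure, isClosed_closure,
    (StarSubalgebra.commRingTopologicalClosure (StarAlgebra.adjoin ℂ R) mul_comm').mul_comm,
    fun f => (StarAlgebra.adjoin ℂ R).le_topologicalClosure
      (StarAlgebra.subset_adjoin ℂ R ⟨f, rfl⟩)⟩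

end Integral

section Spectral

variable {μ : H → Measure α} [∀ ψ, IsFiniteMeasure (μ ψ)]

theorem exists_scalarMeasure_eq (huniv : ∀ ψ, (μ ψ).real Set.univ = ‖ψ‖ ^ 2)
    (hop : ∀ X, MeasurableSet X → ∃ A : H →L[ℂ] H, ∀ ψ, ⟪ψ, A ψ⟫_ℂ = (((μ ψ).real X : ℝ) : ℂ)) :
    ∃ E : POVM α H, ∀ ψ, E.scalarMeasure ψ = μ ψ := by
  classical
  choose! A hA using hop
  let E : POVM α H :=
    { toFun X := if MeasurableSet X then A X else 0
      not_measurable' X hX := if_neg hX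
      isPositive' X hX := by
        rw [if_pos hX]
        refine isPositive_of_inner_self_nonneg fun ψ => ?_
        rw [hA X hX]
        exact_mod_cast measureReal_nonneg
      univ' := by
        rw [if_pos .univ]
        refine ext_of_inner_self fun ψ => ?_
        rw [hA _ .univ, huniv, one_apply_eq_self, inner_self_eq_norm_sq_to_K]
        simp
      empty' := by
        rw [if_pos .empty]
        refine ext_of_inner_self fun ψ => ?_
        rw [hA _ .empty]
        simp
      hasSum' X hX hd φ ψ := by
        simp only [if_pos (hX _), if_pos (MeasurableSet.iUnion hX)]
        exact hasSum_inner_iUnion hA hX hd φ ψ }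
  refine ⟨E, fun ψ => Measure.ext fun X hX => ?_⟩
  have hEX : E X = A X := if_pos hX
  rw [scalarMeasure_apply _ _ hX, hEX, hA X hX, Complex.ofReal_re, ofReal_measureReal]

theorem boundedClosed_exists_inner_self_eq_integral :
    BoundedClosed fun f : α → ℂ => ∃ A : H →L[ℂ] H, ∀ ψ, ⟪ψ, A ψ⟫_ℂ = ∫ x, f x ∂μ ψ where
  add f g hf hg := by
    rintro ⟨A, hA⟩ ⟨B, hB⟩
    refine ⟨A + B, fun ψ => ?_⟩
    rw [add_apply, inner_add_right, hA, hB]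
    exact (integral_add (hf.integrable _) (hg.integrable _)).symm
  smul c f _ := by
    rintro ⟨A, hA⟩
    refine ⟨c • A, fun ψ => ?_⟩
    rw [smul_apply, inner_smul_right, hA]
    exact (integral_smul c f).symm
  lim F f hF hlim h := by
    choose A hA using h
    refine exists_inner_self_eq_of_tendsto_inner_self (A := A) fun ψ => ?_
    simpa only [hA] using hlim.integral hF (μ ψ)

variable {K : Type*} [TopologicalSpace K] [CompactSpace K] [T2Space K] [MeasurableSpace K]
  [BorelSpace K] [SecondCountableTopology K]

theorem exists_integral_eq (Φ : C(K, ℂ) →ₚ[ℂ] H →L[ℂ] H) (h1 : Φ 1 = 1) :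
    ∃ E : POVM K H, ∀ f : C(K, ℂ), E.integral f = Φ f := by
  choose μ hfin hμ using exists_measure_inner_self_eq Φ
  obtain ⟨E, hE⟩ : ∃ E : POVM K H, ∀ ψ, E.scalarMeasure ψ = μ ψ := by
    refine exists_scalarMeasure_eq (fun ψ => ?_) fun X hX => ?_
    · have h := hμ ψ 1
      rw [h1, one_apply_eq_self, inner_self_eq_norm_sq_to_K] at h
      simp only [ContinuousMap.one_apply, integral_const, Complex.real_smul, mul_one] at h
      exact Complex.ofReal_injective (by simpa using h.symm)
    · obtain ⟨A, hA⟩ := isDetermining_continuousMap.induction _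
        boundedClosed_exists_inner_self_eq_integral
        (by rintro _ ⟨f, rfl⟩; exact ⟨Φ f, fun ψ => hμ ψ f⟩) _ (boundedMeasurable_indicator hX)
      exact ⟨A, fun ψ => by rw [hA, integral_indicator_one_complex _ hX]⟩
  exact ⟨E, fun f => E.integral_eq_of_inner_self (boundedMeasurable_continuousMap f)
    fun ψ => by rw [hE, hμ]⟩

theorem exists_isSharp_integral_eq (π : C(K, ℂ) →⋆ₐ[ℂ] (H →L[ℂ] H)) :
    ∃ P : POVM K H, P.IsSharp ∧ ∀ f : C(K, ℂ), P.integral f = π f := by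
  obtain ⟨P, hP⟩ := exists_integral_eq (PositiveLinearMap.ofClass π) (map_one π)
  refine ⟨P, isSharp_of_isDetermining isDetermining_continuousMap ?_, hP⟩
  rintro _ ⟨f, rfl⟩ _ ⟨g, rfl⟩
  rw [← ContinuousMap.coe_mul, hP, hP, hP]
  exact map_mul π f g

end Spectral

end POVM

section Existence

open SubprobabilityMeasure

theorem algHom_nonneg_of_nonneg {A : Type*} [CStarAlgebra A] [PartialOrder A] [StarOrderedRing A]
    {S : StarSubalgebra ℂ A} [IsClosed (S : Set A)] (χ : S →ₐ[ℂ] ℂ) {b : S} (hb : 0 ≤ (b : A)) :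
    0 ≤ χ b := by
  have hχ : χ b ∈ spectrum ℂ (b : A) := by
    rw [← StarSubalgebra.spectrum_eq]
    exact AlgHom.apply_mem_spectrum χ b
  exact spectrum_nonneg_of_nonneg hb hχ

variable {Ω : Type*} [TopologicalSpace Ω] [MeasurableSpace Ω]

theorem exists_starAlgHom_of_characterSpace {A : Type*} [CommCStarAlgebra A] (a : C₀(Ω, ℂ) → A)
    (h : ∀ χ : WeakDual.characterSpace ℂ A, ∃ μ : SubprobabilityMeasure Ω,
      ∀ f : C₀(Ω, ℂ), eval f μ = χ (a f)) :
    ∃ π : C(SubprobabilityMeasure Ω, ℂ) →⋆ₐ[ℂ] A, ∀ f, π (evalMap f) = a f := by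
  choose m hm using h
  have hmc : Continuous m := by
    rw [isInducing_eval.continuous_iff, continuous_pi_iff]
    intro f
    simp only [Function.comp_apply, hm]
    exact (WeakDual.eval_continuous (a f)).comp continuous_subtype_val
  refine ⟨((gelfandStarTransform A).symm : _ →⋆ₐ[ℂ] A).comp
    (ContinuousMap.compStarAlgHom' ℂ ℂ ⟨m, hmc⟩), fun f => ?_⟩
  have hf : ContinuousMap.compStarAlgHom' ℂ ℂ ⟨m, hmc⟩ (evalMap f) =
      gelfandStarTransform A (a f) :=
    ContinuousMap.ext fun χ => hm χ f
  rw [StarAlgHom.comp_apply, hf]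
  exact (gelfandStarTransform A).symm_apply_apply (a f)

namespace POVM

variable [T2Space Ω] [LocallyCompactSpace Ω] [BorelSpace Ω] {H : Type*} [NormedAddCommGroup H]
  [InnerProductSpace ℂ H] [CompleteSpace H] {E : POVM Ω H}

theorem exists_eval_eq_algHom {S : StarSubalgebra ℂ (H →L[ℂ] H)}
    [IsClosed (S : Set (H →L[ℂ] H))] (hS : ∀ f : C₀(Ω, ℂ), E.integral f ∈ S) (χ : S →ₐ[ℂ] ℂ) :
    ∃ μ : SubprobabilityMeasure Ω, ∀ f : C₀(Ω, ℂ), eval f μ = χ ⟨E.integral f, hS f⟩ := by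
  have hadd (f g : C₀(Ω, ℂ)) := E.isSigmaNormal_integral.add f g
    (boundedMeasurable_zeroAtInfty f) (boundedMeasurable_zeroAtInfty g)
  have hsmul c (f : C₀(Ω, ℂ)) :=
    E.isSigmaNormal_integral.smul c f (boundedMeasurable_zeroAtInfty f)
  let Λ : C₀(Ω, ℂ) →ₗ[ℂ] ℂ :=
    { toFun f := χ ⟨E.integral f, hS f⟩
      map_add' f g := (congrArg χ (Subtype.ext (hadd f g))).trans (map_add χ _ _)
      map_smul' c f := (congrArg χ (Subtype.ext (hsmul c f))).trans (map_smul χ c _) }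
  refine (exists_eval_eq_iff Λ).2 ⟨fun f hf => ?_, fun f _ hf1 => ?_⟩
  · exact algHom_nonneg_of_nonneg χ (E.integral_nonneg (boundedMeasurable_zeroAtInfty f) hf)
  · have hb := boundedMeasurable_zeroAtInfty f
    have hsub : E.integral (1 + (-1 : ℂ) • ⇑f) = 1 - E.integral f := by
      rw [E.isSigmaNormal_integral.add _ _ boundedMeasurable_one (hb.smul (-1)),
        E.isSigmaNormal_integral.smul _ _ hb, E.integral_one, neg_one_smul, sub_eq_add_neg]
    have hnonneg : 0 ≤ E.integral (1 + (-1 : ℂ) • ⇑f) :=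
      E.integral_nonneg (boundedMeasurable_one.add (hb.smul (-1))) fun x => by
        simpa [← sub_eq_add_neg] using hf1 x
    have hχ : 0 ≤ χ (1 - ⟨E.integral f, hS f⟩) :=
      algHom_nonneg_of_nonneg χ (hnonneg.trans_eq hsub)
    rwa [map_sub, map_one, sub_nonneg, ← Complex.ofReal_one] at hχ

theorem exists_starAlgHom_evalMap_eq {S : StarSubalgebra ℂ (H →L[ℂ] H)}
    (hclosed : IsClosed (S : Set (H →L[ℂ] H))) (hcomm : ∀ x y : S, x * y = y * x)
    (hS : ∀ f : C₀(Ω, ℂ), E.integral f ∈ S) :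
    ∃ π : C(SubprobabilityMeasure Ω, ℂ) →⋆ₐ[ℂ] (H →L[ℂ] H),
      ∀ f : C₀(Ω, ℂ), π (evalMap f) = E.integral f := by
  have hχ (χ : S →ₐ[ℂ] ℂ) := exists_eval_eq_algHom hS χ
  let : CommCStarAlgebra S :=
    { toCompleteSpace := hclosed.completeSpace_coe
      norm_mul_self_le x := (CStarRing.norm_star_mul_self (x := (x : H →L[ℂ] H))).symm.le
      mul_comm := hcomm }
  obtain ⟨π, hπ⟩ := exists_starAlgHom_of_characterSpace (fun f : C₀(Ω, ℂ) => ⟨E.integral f, hS f⟩)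
    fun χ => hχ (WeakDual.CharacterSpace.toAlgHom χ)
  exact ⟨S.subtype.comp π, fun f => congrArg Subtype.val (hπ f)⟩

end POVM

end Existence

section Representation

open SubprobabilityMeasure

variable {Ω : Type*} [TopologicalSpace Ω] [T2Space Ω] [LocallyCompactSpace Ω]
  [SecondCountableTopology Ω] [MeasurableSpace Ω] [BorelSpace Ω]
  {H : Type*} [NormedAddCommGroup H] [InnerProductSpace ℂ H]

theorem IsSigmaNormal.comp_eval {Φ : (SubprobabilityMeasure Ω → ℂ) → H →L[ℂ] H}
    (hΦ : IsSigmaNormal Φ) : IsSigmaNormal fun f : Ω → ℂ => Φ (eval f) where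
  add f g hf hg := by
    rw [eval_add hf hg, hΦ.add _ _ (boundedMeasurable_eval hf) (boundedMeasurable_eval hg)]
  smul c f hf := by rw [eval_smul, hΦ.smul c _ (boundedMeasurable_eval hf)]
  tendsto_inner F f hF h :=
    hΦ.tendsto_inner _ _ (fun n => boundedMeasurable_eval (hF n)) (tendstoBoundedly_eval hF h)

variable [CompleteSpace H]

namespace POVM

variable {P Q : POVM (SubprobabilityMeasure Ω) H} {E : POVM Ω H}

theorem representsOnFunctions_iff_forall_boundedMeasurable : P.RepresentsOnFunctions E ↔
    ∀ f, BoundedMeasurable f → E.integral f = P.integral (eval f) := by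
  refine ⟨fun h f => isDetermining_zeroAtInfty.eq_of_isSigmaNormal E.isSigmaNormal_integral
    P.isSigmaNormal_integral.comp_eval ?_, fun h f => h f (boundedMeasurable_zeroAtInfty f)⟩
  rintro _ ⟨f, rfl⟩
  exact h f

theorem representsOnSets_iff_forall_boundedMeasurable : P.RepresentsOnSets E ↔
    ∀ f, BoundedMeasurable f → E.integral f = P.integral (eval f) := by
  refine ⟨fun h f => isDetermining_indicator.eq_of_isSigmaNormal E.isSigmaNormal_integral
    P.isSigmaNormal_integral.comp_eval ?_, fun h X hX => ?_⟩
  · rintro _ ⟨X, hX, rfl⟩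
    rw [E.integral_indicator hX, h X hX, eval_indicator hX]
  · rw [← E.integral_indicator hX, h _ (boundedMeasurable_indicator hX), eval_indicator hX]

theorem representsOnFunctions_iff_representsOnSets :
    P.RepresentsOnFunctions E ↔ P.RepresentsOnSets E :=
  representsOnFunctions_iff_forall_boundedMeasurable.trans
    representsOnSets_iff_forall_boundedMeasurable.symm

theorem RepresentsOnFunctions.apply_compl_probabilityMeasures (h : P.RepresentsOnFunctions E) :
    P (probabilityMeasures Ω)ᶜ = 0 := by
  have hone : P.integral (eval 1) = P.integral 1 := by
    rw [← representsOnFunctions_iff_forall_boundedMeasurable.1 h 1 boundedMeasurable_one,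
      E.integral_one, P.integral_one]
  refine ext_of_inner_self fun ψ => ?_
  have hae : ∀ᵐ μ ∂P.scalarMeasure ψ, μ ∈ probabilityMeasures Ω := by
    refine ae_mem_probabilityMeasures ?_
    rw [← P.inner_self_integral (boundedMeasurable_eval boundedMeasurable_one), hone,
      P.inner_self_integral boundedMeasurable_one]
    rfl
  have hnull : P.scalarMeasure ψ (probabilityMeasures Ω)ᶜ = 0 := hae
  simp [P.inner_self_apply measurableSet_probabilityMeasures.compl, measureReal_def, hnull]

theorem IsSharp.eq_of_representsOnFunctions (hP : P.IsSharp) (hQ : Q.IsSharp)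
    (hPE : P.RepresentsOnFunctions E) (hQE : Q.RepresentsOnFunctions E) : P = Q := by
  have htop : StarAlgHom.equalizer hP.starAlgHom hQ.starAlgHom = ⊤ :=
    eq_top_of_evalMap_mem
      (isClosed_eq (map_continuous hP.starAlgHom) (map_continuous hQ.starAlgHom))
      fun f => (hPE f).symm.trans (hQE f)
  refine ext_of_isDetermining isDetermining_continuousMap ?_
  rintro _ ⟨g, rfl⟩
  have hg : g ∈ StarAlgHom.equalizer hP.starAlgHom hQ.starAlgHom := htop ▸ StarSubalgebra.mem_top
  exact hg

theorem IsSharp.commute_integral_of_mem_commutant (hP : P.IsSharp)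
    (hPE : P.RepresentsOnFunctions E) {T : H →L[ℂ] H} (hT : T ∈ E.commutant)
    (g : C(SubprobabilityMeasure Ω, ℂ)) : Commute (P.integral g) T := by
  let S := (StarSubalgebra.centralizer ℂ {T}).comap hP.starAlgHom
  have hclosed : IsClosed (S : Set C(SubprobabilityMeasure Ω, ℂ)) :=
    (Set.isClosed_centralizer _).preimage (map_continuous hP.starAlgHom)
  have hmem (f : C₀(Ω, ℂ)) : evalMap f ∈ S := by
    have hPf : hP.starAlgHom (evalMap f) = E.integral f := (hPE f).symm
    rw [StarSubalgebra.mem_comap, StarSubalgebra.mem_centralizer_iff, hPf]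
    rintro _ rfl
    exact ⟨(mem_commutant_iff.1 hT f).symm, (mem_commutant_iff.1 (star_mem_commutant hT) f).symm⟩
  have hg : g ∈ S := eq_top_of_evalMap_mem hclosed hmem ▸ StarSubalgebra.mem_top
  exact ((StarSubalgebra.mem_centralizer_iff ℂ).1 hg T rfl).1.symm

theorem IsSharp.commutant_eq (hP : P.IsSharp) (hPE : P.RepresentsOnFunctions E) :
    E.commutant = P.commutant := by
  refine Set.Subset.antisymm (fun T hT => ?_) (Set.centralizer_subset ?_)
  · exact mem_commutant_iff.2 fun f =>
      hP.commute_integral_of_mem_commutant hPE hT f.toContinuousMap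
  · rintro _ ⟨f, rfl⟩
    exact ⟨⟨evalMap f, by simp⟩, (hPE f).symm⟩

theorem IsCommutative.exists_isSharp_representsOnFunctions (hE : E.IsCommutative) :
    ∃ P : POVM (SubprobabilityMeasure Ω) H, P.IsSharp ∧ P.RepresentsOnFunctions E := by
  obtain ⟨S, hclosed, hcomm, hS⟩ := hE.exists_starSubalgebra
  obtain ⟨π, hπ⟩ := exists_starAlgHom_evalMap_eq hclosed hcomm hS
  obtain ⟨P, hP, hPπ⟩ := exists_isSharp_integral_eq π
  exact ⟨P, hP, fun f => (hπ f).symm.trans (hPπ (evalMap f)).symm⟩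

end POVM

end Representation

end

theorem theorem2_general {Ω : Type*} [TopologicalSpace Ω] [T2Space Ω] [LocallyCompactSpace Ω]
    [SecondCountableTopology Ω] [MeasurableSpace Ω] [BorelSpace Ω]
    {H : Type*} [NormedAddCommGroup H] [InnerProductSpace ℂ H] [CompleteSpace H]
    (E : POVM Ω H) (hE : E.IsCommutative) :
    (∃! P : POVM (SubprobabilityMeasure Ω) H, P.IsSharp ∧ P.RepresentsOnFunctions E) ∧
    (∀ P : POVM (SubprobabilityMeasure Ω) H,
      P.RepresentsOnFunctions E ↔ P.RepresentsOnSets E) ∧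
    MeasurableSet (SubprobabilityMeasure.probabilityMeasures Ω) ∧
    (∀ P : POVM (SubprobabilityMeasure Ω) H, P.RepresentsOnFunctions E →
      P (SubprobabilityMeasure.probabilityMeasures Ω)ᶜ = 0 ∧
      (P.IsSharp → E.commutant = P.commutant)) := by
  refine ⟨?_, fun P => POVM.representsOnFunctions_iff_representsOnSets,
    SubprobabilityMeasure.measurableSet_probabilityMeasures,
    fun P hPE => ⟨hPE.apply_compl_probabilityMeasures, fun hP => hP.commutant_eq hPE⟩⟩
  obtain ⟨P, hP, hPE⟩ := hE.exists_isSharp_representsOnFunctions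
  exact ⟨P, ⟨hP, hPE⟩, fun Q ⟨hQ, hQE⟩ => hQ.eq_of_representsOnFunctions hP hQE hPE⟩

theorem theorem2 {Ω : Type*} [TopologicalSpace Ω] [T2Space Ω] [LocallyCompactSpace Ω]
    [SecondCountableTopology Ω] [MeasurableSpace Ω] [BorelSpace Ω]
    {H : Type*} [NormedAddCommGroup H] [InnerProductSpace ℂ H] [CompleteSpace H]
    [TopologicalSpace.SeparableSpace H]
    (E : POVM Ω H) (hE : E.IsCommutative) :
    (∃! P : POVM (SubprobabilityMeasure Ω) H, P.IsSharp ∧ P.RepresentsOnFunctions E) ∧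
    (∀ P : POVM (SubprobabilityMeasure Ω) H, P.IsSharp →
      (P.RepresentsOnFunctions E ↔ P.RepresentsOnSets E)) ∧
    (∀ P : POVM (SubprobabilityMeasure Ω) H, P.IsSharp → P.RepresentsOnFunctions E →
      MeasurableSet (SubprobabilityMeasure.probabilityMeasures Ω) ∧
      P (SubprobabilityMeasure.probabilityMeasures Ω)ᶜ = 0 ∧
      E.commutant = P.commutant) := by
  obtain ⟨hex, hiff, hmeas, h⟩ := theorem2_general E hE
  exact ⟨hex, fun P _ => hiff P, fun P hP hPE => ⟨hmeas, (h P hPE).1, (h P hPE).2 hP⟩⟩
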